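/- Let $(X,\mathfrak M,\mu)$ be a measure space. A family $\mathfrak B\subset\mathfrak M$ (its members are called balls) is a ball-basis with constant $\mathcal K$ if: (B1) $0<\mu(B)<\infty$ for every $B\in\mathfrak B$; (B2) any two points of $X$ lie in a common ball; (B3) for every $E\in\mathfrak M$ and $\varepsilon>0$ there is a finite (possibly empty) or infinite sequence of balls $B_k$ with $\mu(E\bigtriangleup\bigcup_kB_k)<\varepsilon$; (B4) every ball $B$ has a hull, i.e. a ball $B^*$ with $\mu(B^*)\le\mathcal K\mu(B)$ that contains every ball $A$ with $\mu(A)\le 2\mu(B)$ and $A\cap B\ne\varnothing$. A hull $B^*$ of each ball $B$ is fixed once and for all. Let $1\le r<\infty$. For $f\in L^r(X)$ (real- or complex-valued) and $B\in\mathfrak B$ put $$\langle f\rangle_{B,r}=\Big(\frac1{\mu(B)}\int_B|f|^r\,d\mu\Big)^{1/r},\qquad \langle f\rangle^*_{B,r}=\sup_{A\in\mathfrak B,\,A\supset B}\langle f\rangle_{A,r}.$$ Let $T$ map $L^r(X)$ to (not necessarily measurable) functions on $X$ and be subadditive: $|T(cf)(x)|=|c||Tf(x)|$ for $c\in\mathbb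 R$ and $|T(f+g)(x)|\le|Tf(x)|+|Tg(x)|$, for all $x\in X$. $T$ is a bounded oscillation (BO) operator with respect to $\mathfrak B$ if (T1) $$\mathcal L_1(T)=\sup_{B\in\mathfrak B}\ \sup_{x,x'\in B,\ f\in L^r(X)}\frac{|T(f\mathbf 1_{X\setminus B^*})(x)-T(f\mathbf 1_{X\setminus B^*})(x')|}{\langle f\rangle^*_{B,r}}<\infty;$$ (T2) there is a constant $c<\infty$ such that for every ball $A$ with $A^*\ne X$ there is a ball $B\supsetneq A$ with $$\sup_{x\in A,\ f\in L^r(X)}\frac{|T(f\mathbf 1_{B^*\setminus A^*})(x)|}{\langle f\rangle_{B^*,r}}\le c;$$ the infimum of such $c$ is denoted $\mathcal L_2(T)$. (Here $0/0=0$ and $a/0=\infty$ for $a>0$.) $T$ satisfies the weak-$L^r$ inequality if $$\|T\|_{L^r\to L^{r,\infty}}=\sup_{t>0,\ f\in L^r(X)}\frac{t\,\mu^*\{x:|Tf(x)|>t\}^{1/r}}{\|f\|_{L^r}}<\infty,$$ where $\mu^*$ is the outer measure of $\mu$. The maximal truncation of $T$ is $$T^*f(x)=\sup_{B\in\mathfrak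 B,\ x\in B}|T(f\mathbf 1_{X\setminus B^*})(x)|\in[0,\infty].$$ For $0<\gamma<1$, a collection $\mathcal S\subset\mathfrak B$ is $\gamma$-sparse if there are pairwise disjoint measurable sets $E_B\subset B$, $B\in\mathcal S$, with $\mu(E_B)\ge\gamma\mu(B)$. For a collection of balls $\mathcal S$ put $\mathcal A_{\mathcal S,r}f(x)=\sum_{A\in\mathcal S}\langle f\rangle_{A,r}\mathbf 1_A(x)$. **Theorem.** For every $\mathcal K$ there are constants $0<\gamma<1$ and $C>0$, depending only on $\mathcal K$, with the following property. Let $\mathfrak B$ be a ball-basis with constant $\mathcal K$ on a measure space $(X,\mathfrak M,\mu)$, let $1\le r<\infty$, and let $T$ be a BO operator with respect to $\mathfrak B$ that satisfies the weak-$L^r$ inequality. Then for every $f\in L^r(X)$ and every ball $B\in\mathfrak B$ there is a family of balls $\mathcal S$, which is a union of two $\gamma$-sparse collections, such that $$T^*f(x)\le C\,\big(\mathcal L_1(T)+\mathcal L_2(T)+\|T\|_{L^r\to L^{r,\infty}}\big)\,\mathcal A_{\mathcal S,r}f(x)\qquad\text{for a.e. }x\in B.$$ -/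

import Mathlib

open MeasureTheory Set
open scoped ENNReal NNReal symmDiff

/-- A ball-basis `balls` of a measure space `(X, μ)` with constant `K`, together with a choice
`B ↦ hull B` of a hull `B*` of every ball `B`. -/
structure BallBasis {X : Type*} [MeasurableSpace X] (μ : Measure X) (K : ℝ≥0) where
  /-- the family of balls -/
  balls : Set (Set X)
  /-- the chosen hull `B*` of a ball `B` (no meaning if `B` is not a ball) -/
  hull : Set X → Set X
  measurableSet_ball : ∀ B ∈ balls, MeasurableSet B
  measure_pos : ∀ B ∈ balls, 0 < μ B
  measure_lt_top : ∀ B ∈ balls, μ B < ∞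
  exists_ball : ∀ x y : X, ∃ B ∈ balls, x ∈ B ∧ y ∈ B
  /-- measurable sets are approximated by unions of finite (possibly empty) or infinite
  sequences of balls -/
  approx : ∀ E : Set X, MeasurableSet E → ∀ ε : ℝ≥0∞, 0 < ε →
    ∃ 𝒞 : Set (Set X), 𝒞.Countable ∧ 𝒞 ⊆ balls ∧ μ (E ∆ ⋃₀ 𝒞) < ε
  hull_mem : ∀ B ∈ balls, hull B ∈ balls
  subset_hull : ∀ B ∈ balls, ∀ A ∈ balls, μ A ≤ 2 * μ B → (A ∩ B).Nonempty → A ⊆ hull B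
  measure_hull_le : ∀ B ∈ balls, μ (hull B) ≤ K * μ B

section Operators

variable {X : Type*} [MeasurableSpace X] {𝕜 : Type*} [RCLike 𝕜]

/-- The average `⟨f⟩_{B,r} = (μ(B)⁻¹ ∫_B |f|^r)^{1/r}`. -/
noncomputable def avg (μ : Measure X) (r : ℝ) (f : X → 𝕜) (B : Set X) : ℝ≥0∞ :=
  ((∫⁻ x in B, ‖f x‖ₑ ^ r ∂μ) / μ B) ^ (1 / r)

/-- The quantity `⟨f⟩*_{B,r}`, the supremum of `⟨f⟩_{A,r}` over the balls `A ⊇ B`. -/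
noncomputable def avgStar {μ : Measure X} {K : ℝ≥0} (𝓑 : BallBasis μ K) (r : ℝ)
    (f : X → 𝕜) (B : Set X) : ℝ≥0∞ :=
  ⨆ A ∈ 𝓑.balls, ⨆ _ : B ⊆ A, avg μ r f A

/-- `T`, considered on `L^r(X)`, is subadditive: `|T(c f)| = |c| |T f|` for real `c`, and
`|T(f + g)| ≤ |T f| + |T g|`, at every point. Values of `T` need not be measurable functions. -/
def IsSubadditiveOp (μ : Measure X) (r : ℝ) (T : (X → 𝕜) → X → 𝕜) : Prop :=
  (∀ f, MemLp f (ENNReal.ofReal r) μ → ∀ (c : ℝ) (x : X), ‖T (c • f) x‖ = |c| * ‖T f x‖) ∧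
  (∀ f g, MemLp f (ENNReal.ofReal r) μ → MemLp g (ENNReal.ofReal r) μ →
    ∀ x : X, ‖T (f + g) x‖ ≤ ‖T f x‖ + ‖T g x‖)

/-- The localization constant `L₁(T)`. Quotients in `ℝ≥0∞` have `0 / 0 = 0` and
`a / 0 = ∞` for `a ≠ 0`. -/
noncomputable def constL1 {μ : Measure X} {K : ℝ≥0} (𝓑 : BallBasis μ K) (r : ℝ)
    (T : (X → 𝕜) → X → 𝕜) : ℝ≥0∞ :=
  ⨆ B ∈ 𝓑.balls, ⨆ x ∈ B, ⨆ x' ∈ B, ⨆ (f : X → 𝕜) (_ : MemLp f (ENNReal.ofReal r) μ),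
    ‖T ((𝓑.hull B)ᶜ.indicator f) x - T ((𝓑.hull B)ᶜ.indicator f) x'‖ₑ / avgStar 𝓑 r f B

/-- `Δ(A, B)`, the supremum over `x ∈ A` and `f ∈ L^r(X)` of
`|T(f · 1_{B* ∖ A*})(x)| / ⟨f⟩_{B*,r}`. -/
noncomputable def opDelta {μ : Measure X} {K : ℝ≥0} (𝓑 : BallBasis μ K) (r : ℝ)
    (T : (X → 𝕜) → X → 𝕜) (A B : Set X) : ℝ≥0∞ :=
  ⨆ x ∈ A, ⨆ (f : X → 𝕜) (_ : MemLp f (ENNReal.ofReal r) μ),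
    ‖T ((𝓑.hull B \ 𝓑.hull A).indicator f) x‖ₑ / avg μ r f (𝓑.hull B)

/-- The connectivity constant `L₂(T)`: the infimum of the `c` such that every ball `A` with
`A* ≠ X` is strictly contained in some ball `B` with `Δ(A, B) ≤ c`. -/
noncomputable def constL2 {μ : Measure X} {K : ℝ≥0} (𝓑 : BallBasis μ K) (r : ℝ)
    (T : (X → 𝕜) → X → 𝕜) : ℝ≥0∞ :=
  sInf {c : ℝ≥0∞ | ∀ A ∈ 𝓑.balls, 𝓑.hull A ≠ univ →
    ∃ B ∈ 𝓑.balls, A ⊂ B ∧ opDelta 𝓑 r T A B ≤ c}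

/-- `T` is a bounded oscillation operator with respect to the ball-basis `𝓑`. -/
structure IsBO {μ : Measure X} {K : ℝ≥0} (𝓑 : BallBasis μ K) (r : ℝ)
    (T : (X → 𝕜) → X → 𝕜) : Prop where
  subadditive : IsSubadditiveOp μ r T
  localization : constL1 𝓑 r T < ∞
  connectivity : constL2 𝓑 r T < ∞

/-- The weak norm `‖T‖_{L^r → L^{r,∞}}`; `μ` of a nonmeasurable set is its outer measure. -/
noncomputable def weakNorm (μ : Measure X) (r : ℝ) (T : (X → 𝕜) → X → 𝕜) : ℝ≥0∞ :=
  ⨆ (t : ℝ≥0) (_ : 0 < t) (f : X → 𝕜) (_ : MemLp f (ENNReal.ofReal r) μ),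
    (t * μ {x | (t : ℝ) < ‖T f x‖} ^ (1 / r)) / eLpNorm f (ENNReal.ofReal r) μ

/-- The maximal truncation `T* f(x)`, the supremum of `|T(f · 1_{X ∖ B*})(x)|` over the
balls `B ∋ x`; it may be infinite at some points. -/
noncomputable def maxTrunc {μ : Measure X} {K : ℝ≥0} (𝓑 : BallBasis μ K)
    (T : (X → 𝕜) → X → 𝕜) (f : X → 𝕜) (x : X) : ℝ≥0∞ :=
  ⨆ B ∈ 𝓑.balls, ⨆ _ : x ∈ B, ‖T ((𝓑.hull B)ᶜ.indicator f) x‖ₑ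

/-- `𝒮` is a `γ`-sparse collection of balls. -/
def IsSparse {μ : Measure X} {K : ℝ≥0} (𝓑 : BallBasis μ K) (γ : ℝ≥0)
    (𝒮 : Set (Set X)) : Prop :=
  𝒮 ⊆ 𝓑.balls ∧ ∃ E : Set X → Set X,
    (∀ B ∈ 𝒮, MeasurableSet (E B) ∧ E B ⊆ B ∧ γ * μ B ≤ μ (E B)) ∧ 𝒮.PairwiseDisjoint E

/-- The operator `𝒜_{𝒮,r} f(x) = ∑_{A ∈ 𝒮} ⟨f⟩_{A,r} 1_A(x)`. -/
noncomputable def sparseOp (μ : Measure X) (r : ℝ) (𝒮 : Set (Set X)) (f : X → 𝕜) (x : X) :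
    ℝ≥0∞ :=
  ∑' A : 𝒮, (A : Set X).indicator (fun _ => avg μ r f A) x

end Operators

/-!
The bound holds at every point of `B`, not only almost everywhere, because the maximal truncation
only involves truncations at balls. Let `ℓ` bound the three constants of `T`, and split `f` into its
restrictions to a hull `U` around `B` and to the complement of `U`. Each part is dominated by one of
the two sparse collections.

*Comparison of truncations.* For a ball `A` and `x ∈ A`, the weak-type inequality provides a point
of `A` where `T (g 1_{X ∖ A*})` is small and localization carries this over to `x`
(`IsBOWith.enorm_compl_hull_le`). Hence truncations at balls of comparable measure differ by a
multiple of an average. The connectivity condition is needed only across gaps in the scale of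
measures, and yields for every ball `A` a ball of at least `2 K` times its measure to which one can
pass at the cost of two averages (`IsBOWith.exists_larger_ball`).

*Far part.* Iterating this from a ball around `B` gives a chain of balls of geometrically growing
measure, hence a sparse family, along which the truncation telescopes; the remainder tends to zero
by the weak-type inequality (`IsBOWith.exists_sparse_compl_hull`). As the chain does not depend on
the function, it serves all the functions `f 1_{X ∖ A*}` at once.

*Local part.* A Cotlar-type inequality shows that the maximal truncation is of weak type
(`IsBOWith.mul_measure_maxTrunc_gt_le`). So every ball `P` has an exceptional set of measure at most
`ε μ(P)` off which the maximal truncation and the maximal function of `f 1_{U(P)}`, where `U(P)` is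
a hull around `P`, are bounded by multiples of the average of `f`. Now balls are selected level by
level, in order of decreasing measure (`BallBasis.selection`): each point carries a current ball,
starting with `B`; a maximal disjoint family is selected among the balls of the given level that are
substantially exceptional for the current ball of one of their points; and all points in the hull of
a selected ball are reassigned to it. In the absence of a dyadic structure, this reassignment
of whole hulls is what keeps descendants of different balls from piling up: the balls that are
selected after `Q` and meet it descend from selected balls near `Q` of boundedly many comparable
levels, and the masses of successive generations decay geometrically, so they cover at most half of
`Q` (`BallBasis.measure_inter_later_le`). For a ball `A` around `x`, telescope along the balls
assigned to `x` up to the level of `A`. At that stage `A` is not substantially exceptional, so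
localization bounds the remaining truncation (`IsBOWith.exists_sparse_localSupport`).

All constants are uniform in `r`, since a constant `c ≥ 1` satisfies `c ^ (1 / r) ≤ c`.
-/

/-! ### Geometry of a ball-basis -/

namespace BallBasis

variable {X : Type*} [MeasurableSpace X] {μ : Measure X} {K : ℝ≥0} (𝓑 : BallBasis μ K)
  {A B D : Set X}

include 𝓑

lemma nonempty_of_mem (hB : B ∈ 𝓑.balls) : B.Nonempty :=
  nonempty_of_measure_ne_zero (𝓑.measure_pos B hB).ne'

lemma subset_hull_self (hB : B ∈ 𝓑.balls) : B ⊆ 𝓑.hull B :=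
  𝓑.subset_hull B hB B hB (le_mul_of_one_le_left' one_le_two)
    (by simpa using 𝓑.nonempty_of_mem hB)

lemma one_le_const (hB : B ∈ 𝓑.balls) : 1 ≤ K := by
  have h := (measure_mono (𝓑.subset_hull_self hB)).trans (𝓑.measure_hull_le B hB)
  by_contra hK
  have h2 : (K : ℝ≥0∞) * μ B < 1 * μ B :=
    ENNReal.mul_lt_mul_left (𝓑.measure_pos B hB).ne' (𝓑.measure_lt_top B hB).ne
      (by exact_mod_cast not_le.1 hK)
  exact absurd h (by simpa using h2)

lemma measurableSet_hull (hB : B ∈ 𝓑.balls) : MeasurableSet (𝓑.hull B) :=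
  𝓑.measurableSet_ball _ (𝓑.hull_mem B hB)

lemma measure_hull_hull_le (hB : B ∈ 𝓑.balls) : μ (𝓑.hull (𝓑.hull B)) ≤ K ^ 2 * μ B := by
  calc μ (𝓑.hull (𝓑.hull B)) ≤ K * μ (𝓑.hull B) := 𝓑.measure_hull_le _ (𝓑.hull_mem B hB)
    _ ≤ K * (K * μ B) := by gcongr; exact 𝓑.measure_hull_le B hB
    _ = K ^ 2 * μ B := by ring

/-- For a ball `A` whose measure is within a factor `2` of the largest possible, the double hull
`A**` works. -/
lemma exists_dilate (L : ℝ≥0) (hL : 1 ≤ L) (hB : B ∈ 𝓑.balls) :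
    ∃ N ∈ 𝓑.balls, (∀ D ∈ 𝓑.balls, μ D ≤ L * μ B → (D ∩ B).Nonempty → D ⊆ N) ∧
      μ N ≤ K ^ 2 * L * μ B := by
  set s : ℝ≥0∞ := ⨆ D ∈ {D ∈ 𝓑.balls | μ D ≤ L * μ B ∧ (D ∩ B).Nonempty}, μ D with hs
  have hle : ∀ D ∈ 𝓑.balls, μ D ≤ L * μ B → (D ∩ B).Nonempty → μ D ≤ s :=
    fun D hD h1 h2 => le_biSup (f := fun D => μ D) (show D ∈ {D ∈ 𝓑.balls | _} from ⟨hD, h1, h2⟩)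
  have hBs : μ B ≤ s := hle B hB (le_mul_of_one_le_left' (by exact_mod_cast hL))
    (by simpa using 𝓑.nonempty_of_mem hB)
  have hs0 : s ≠ 0 := ((𝓑.measure_pos B hB).trans_le hBs).ne'
  have hsL : s ≤ L * μ B := iSup₂_le fun D hD => hD.2.1
  have hst : s ≠ ∞ :=
    (hsL.trans_lt (ENNReal.mul_lt_top ENNReal.coe_lt_top (𝓑.measure_lt_top B hB))).ne
  have hlt : s / 2 < s := ENNReal.half_lt_self hs0 hst
  obtain ⟨A, ⟨hA, hAL, hAB⟩, hAs⟩ := lt_biSup_iff.1 (hs ▸ hlt)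
  have hsA : s ≤ 2 * μ A := by
    rw [mul_comm]; exact (ENNReal.div_le_iff (by simp) (by simp)).1 hAs.le
  have hBA : B ⊆ 𝓑.hull A := 𝓑.subset_hull A hA B hB (hBs.trans hsA) (by rwa [inter_comm])
  refine ⟨𝓑.hull (𝓑.hull A), 𝓑.hull_mem _ (𝓑.hull_mem _ hA), fun D hD h1 h2 => ?_, ?_⟩
  · refine 𝓑.subset_hull _ (𝓑.hull_mem _ hA) D hD ?_ (h2.mono (inter_subset_inter_right _ hBA))
    calc μ D ≤ 2 * μ A := (hle D hD h1 h2).trans hsA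
      _ ≤ 2 * μ (𝓑.hull A) := by gcongr; exact 𝓑.subset_hull_self hA
  · calc μ (𝓑.hull (𝓑.hull A)) ≤ K ^ 2 * μ A := 𝓑.measure_hull_hull_le hA
      _ ≤ K ^ 2 * (L * μ B) := by gcongr
      _ = K ^ 2 * L * μ B := by ring

open Classical in
/-- The `L`-dilate of a ball `B`: a chosen ball, of measure at most `K² L μ(B)`, that contains every
ball meeting `B` of measure at most `L μ(B)`. Iterated hulls do not serve this purpose, since their
measures need not grow at all. For sets that are not balls the value is junk. -/
noncomputable def dilate (L : ℝ≥0) (B : Set X) : Set X :=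
  if h : ∃ N ∈ 𝓑.balls, (∀ D ∈ 𝓑.balls, μ D ≤ L * μ B → (D ∩ B).Nonempty → D ⊆ N) ∧
      μ N ≤ K ^ 2 * L * μ B then h.choose else B

section dilate

variable {L : ℝ≥0} (hL : 1 ≤ L) (hB : B ∈ 𝓑.balls)
include hL hB

lemma dilate_spec : 𝓑.dilate L B ∈ 𝓑.balls ∧
    (∀ D ∈ 𝓑.balls, μ D ≤ L * μ B → (D ∩ B).Nonempty → D ⊆ 𝓑.dilate L B) ∧
      μ (𝓑.dilate L B) ≤ K ^ 2 * L * μ B := by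
  have h := 𝓑.exists_dilate L hL hB
  rw [dilate, dif_pos h]
  exact h.choose_spec

lemma dilate_mem : 𝓑.dilate L B ∈ 𝓑.balls := (𝓑.dilate_spec hL hB).1

lemma subset_dilate (hD : D ∈ 𝓑.balls) (h : μ D ≤ L * μ B) (hDB : (D ∩ B).Nonempty) :
    D ⊆ 𝓑.dilate L B := (𝓑.dilate_spec hL hB).2.1 D hD h hDB

lemma subset_dilate_self : B ⊆ 𝓑.dilate L B :=
  𝓑.subset_dilate hL hB hB (le_mul_of_one_le_left' (by exact_mod_cast hL))
    (by simpa using 𝓑.nonempty_of_mem hB)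

lemma measure_dilate_le : μ (𝓑.dilate L B) ≤ K ^ 2 * L * μ B := (𝓑.dilate_spec hL hB).2.2

end dilate

/-- The Vitali covering argument. -/
lemma measure_sUnion_le {𝒞 : Set (Set X)} (h𝒞 : 𝒞 ⊆ 𝓑.balls) (ν : Measure X) [IsFiniteMeasure ν]
    (hν : ∀ D ∈ 𝒞, μ D ≤ ν D) : μ (⋃₀ 𝒞) ≤ K * ν univ := by
  obtain ⟨u, hu𝒞, hud, hu⟩ := Vitali.exists_disjoint_subfamily_covering_enlargement
    (fun D : Set X => D) 𝒞 (fun D => (μ D).toReal) 2 one_lt_two (fun _ _ => ENNReal.toReal_nonneg)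
    (ν univ).toReal (fun D hD => ENNReal.toReal_mono (measure_ne_top _ _)
      ((hν D hD).trans (measure_mono (subset_univ _))))
    (fun D hD => 𝓑.nonempty_of_mem (h𝒞 hD))
  have hmeas : ∀ D : u, MeasurableSet (D : Set X) :=
    fun D => 𝓑.measurableSet_ball _ (h𝒞 (hu𝒞 D.2))
  have hdisj : Pairwise (Function.onFun Disjoint (fun D : u => (D : Set X))) :=
    fun D D' h => hud D.2 D'.2 (fun h' => h (Subtype.ext h'))
  have hcount : u.Countable := by
    have h := Measure.countable_meas_pos_of_disjoint_iUnion (μ := ν) hmeas hdisj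
    have : {D : u | 0 < ν (D : Set X)} = univ := eq_univ_of_forall fun D =>
      (𝓑.measure_pos _ (h𝒞 (hu𝒞 D.2))).trans_le (hν _ (hu𝒞 D.2))
    rw [this, countable_univ_iff] at h
    exact countable_coe_iff.1 h
  have : Countable u := hcount.to_subtype
  calc μ (⋃₀ 𝒞) ≤ μ (⋃ D : u, 𝓑.hull D) := by
        refine measure_mono (sUnion_subset fun D hD => ?_)
        obtain ⟨D', hD', hne, hle⟩ := hu D hD
        refine subset_iUnion_of_subset ⟨D', hD'⟩ ?_
        refine 𝓑.subset_hull D' (h𝒞 (hu𝒞 hD')) D (h𝒞 hD) ?_ hne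
        rw [← ENNReal.toReal_le_toReal (𝓑.measure_lt_top _ (h𝒞 hD)).ne
          (ENNReal.mul_ne_top (by simp) (𝓑.measure_lt_top _ (h𝒞 (hu𝒞 hD'))).ne)]
        simpa using hle
    _ ≤ ∑' D : u, μ (𝓑.hull D) := measure_iUnion_le _
    _ ≤ ∑' D : u, K * ν D := by
        gcongr with D
        exact (𝓑.measure_hull_le _ (h𝒞 (hu𝒞 D.2))).trans (mul_le_mul' le_rfl (hν _ (hu𝒞 D.2)))
    _ = K * ∑' D : u, ν D := ENNReal.tsum_mul_left
    _ ≤ K * ν univ := by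
        gcongr
        exact (tsum_meas_le_meas_iUnion_of_disjoint ν hmeas hdisj).trans
          (measure_mono (subset_univ _))

end BallBasis

/-! ### Averages -/

section Mean

variable {X : Type*} [MeasurableSpace X] {𝕜 : Type*} [RCLike 𝕜] {μ : Measure X} {r : ℝ}
  {f g : X → 𝕜} {m m' : ℝ≥0∞} {D D' : Set X}

/-- The normalized `L^r` norm `(m⁻¹ ∫ |g|^r)^{1/r}`, for a mass `m` that need not be the measure of
a set carrying `g`. -/
noncomputable def mean (μ : Measure X) (r : ℝ) (g : X → 𝕜) (m : ℝ≥0∞) : ℝ≥0∞ :=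
  ((∫⁻ x, ‖g x‖ₑ ^ r ∂μ) / m) ^ (1 / r)

lemma lintegral_enorm_indicator_rpow (hr : 1 ≤ r) (hD : MeasurableSet D) (g : X → 𝕜) :
    ∫⁻ x, ‖D.indicator g x‖ₑ ^ r ∂μ = ∫⁻ x in D, ‖g x‖ₑ ^ r ∂μ := by
  rw [← lintegral_indicator hD]
  congr 1 with x
  by_cases hx : x ∈ D <;> simp [hx, (zero_lt_one.trans_le hr)]

lemma mean_indicator (hr : 1 ≤ r) (hD : MeasurableSet D) (g : X → 𝕜) :
    mean μ r (D.indicator g) (μ D) = avg μ r g D := by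
  rw [mean, avg, lintegral_enorm_indicator_rpow hr hD]

lemma mean_mono (hr : 1 ≤ r) (h : ∀ x, ‖f x‖ₑ ≤ ‖g x‖ₑ) : mean μ r f m ≤ mean μ r g m := by
  have : 0 ≤ r := zero_le_one.trans hr
  unfold mean
  gcongr with x
  exact h x

lemma mean_indicator_le (hr : 1 ≤ r) : mean μ r (D.indicator g) m ≤ mean μ r g m :=
  mean_mono hr fun x => enorm_indicator_le_enorm_self g x

lemma mean_anti (hr : 1 ≤ r) (h : m ≤ m') : mean μ r g m' ≤ mean μ r g m := by
  have : 0 ≤ r := zero_le_one.trans hr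
  unfold mean
  gcongr

lemma rpow_mul_le (hr : 1 ≤ r) {c : ℝ≥0} (hc : 1 ≤ c) (a : ℝ≥0∞) :
    (c * a) ^ (1 / r) ≤ c * a ^ (1 / r) := by
  have h0 : 0 < r := zero_lt_one.trans_le hr
  rw [ENNReal.mul_rpow_of_nonneg _ _ (by positivity)]
  gcongr
  calc (c : ℝ≥0∞) ^ (1 / r) ≤ (c : ℝ≥0∞) ^ (1 : ℝ) :=
        ENNReal.rpow_le_rpow_of_exponent_le (by exact_mod_cast hc) ((div_le_one h0).2 hr)
    _ = c := ENNReal.rpow_one _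

/-- Comparison of means with a constant that does not depend on `r`. -/
lemma mean_le_mul (hr : 1 ≤ r) {c : ℝ≥0} (hc : 1 ≤ c) (h : m' ≤ c * m) :
    mean μ r g m ≤ c * mean μ r g m' := by
  have h0 : 0 < r := zero_lt_one.trans_le hr
  refine le_trans ?_ (rpow_mul_le hr hc _)
  unfold mean
  gcongr
  have hc0 : (c : ℝ≥0∞) ≠ 0 := by
    have : (0 : ℝ≥0) < c := zero_lt_one.trans_le hc
    exact_mod_cast this.ne'
  rw [← mul_div_assoc, ENNReal.div_eq_inv_mul, ENNReal.div_eq_inv_mul, ← mul_assoc]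
  gcongr
  rw [mul_comm, ← div_eq_mul_inv]
  refine (ENNReal.le_div_iff_mul_le (Or.inr hc0) (Or.inr ENNReal.coe_ne_top)).2 ?_
  rw [mul_comm, ← div_eq_mul_inv]
  exact ENNReal.div_le_of_le_mul h

lemma avg_le_mean (hr : 1 ≤ r) : avg μ r g D ≤ mean μ r g (μ D) := by
  have : 0 ≤ r := zero_le_one.trans hr
  unfold mean avg
  gcongr
  exact Measure.restrict_le_self

lemma avg_mono (hr : 1 ≤ r) (h : ∀ x, ‖f x‖ₑ ≤ ‖g x‖ₑ) : avg μ r f D ≤ avg μ r g D := by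
  have : 0 ≤ r := zero_le_one.trans hr
  unfold avg
  gcongr with x
  exact h x

lemma avg_indicator_le (hr : 1 ≤ r) : avg μ r (D'.indicator g) D ≤ avg μ r g D :=
  avg_mono hr fun x => enorm_indicator_le_enorm_self g x

lemma avg_le_mul_avg (hr : 1 ≤ r) (hD : MeasurableSet D) (hD' : MeasurableSet D') (h : D ⊆ D')
    {c : ℝ≥0} (hc : 1 ≤ c) (hm : μ D' ≤ c * μ D) : avg μ r g D ≤ c * avg μ r g D' := by
  rw [← mean_indicator hr hD, ← mean_indicator hr hD']
  refine (mean_le_mul hr hc hm).trans ?_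
  gcongr
  refine mean_mono hr fun x => ?_
  by_cases hx : x ∈ D
  · simp [hx, h hx]
  · simp [hx]

lemma mean_ne_top (hr : 1 ≤ r) (hg : MemLp g (ENNReal.ofReal r) μ) (hm : m ≠ 0) :
    mean μ r g m ≠ ∞ := by
  have h0 : 0 < r := zero_lt_one.trans_le hr
  have h := hg.2
  rw [eLpNorm_eq_lintegral_rpow_enorm_toReal (by simpa using h0) (by simp),
    ENNReal.toReal_ofReal h0.le, ENNReal.rpow_lt_top_iff_of_pos (by positivity)] at h
  exact ENNReal.rpow_ne_top_of_nonneg (by positivity) (ENNReal.div_ne_top h.ne hm)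

lemma eLpNorm_eq_mean (hr : 1 ≤ r) (hm : m ≠ 0) (hm' : m ≠ ∞) :
    eLpNorm g (ENNReal.ofReal r) μ = mean μ r g m * m ^ (1 / r) := by
  have h0 : 0 < r := zero_lt_one.trans_le hr
  rw [eLpNorm_eq_lintegral_rpow_enorm_toReal (by simpa using h0) (by simp),
    ENNReal.toReal_ofReal h0.le, mean, ← ENNReal.mul_rpow_of_nonneg _ _ (by positivity),
    ENNReal.div_mul_cancel hm hm']

lemma avgStar_le_mean {K : ℝ≥0} {𝓑 : BallBasis μ K} (hr : 1 ≤ r) :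
    avgStar 𝓑 r g D ≤ mean μ r g (μ D) :=
  iSup₂_le fun _ _ => iSup_le fun h => (avg_le_mean hr).trans (mean_anti hr (measure_mono h))

end Mean

/-! ### Operators of bounded oscillation -/

section Operator

variable {X : Type*} [MeasurableSpace X] {𝕜 : Type*} [RCLike 𝕜] {μ : Measure X} {K : ℝ≥0}

/-- `T` is a bounded oscillation operator of weak type `(r, r)`, with all three constants bounded by
the single positive number `ℓ`, and with the quotients cleared. -/
structure IsBOWith (𝓑 : BallBasis μ K) (r : ℝ) (T : (X → 𝕜) → X → 𝕜) (ℓ : ℝ≥0) : Prop where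
  one_le : 1 ≤ r
  subadditive : IsSubadditiveOp μ r T
  enorm_sub_le : ∀ B ∈ 𝓑.balls, ∀ x ∈ B, ∀ x' ∈ B, ∀ f : X → 𝕜, MemLp f (ENNReal.ofReal r) μ →
    ‖T ((𝓑.hull B)ᶜ.indicator f) x - T ((𝓑.hull B)ᶜ.indicator f) x'‖ₑ ≤ ℓ * avgStar 𝓑 r f B
  exists_ssuperset : ∀ A ∈ 𝓑.balls, 𝓑.hull A ≠ univ → ∃ B ∈ 𝓑.balls, A ⊂ B ∧ ∀ x ∈ A,
    ∀ f : X → 𝕜, MemLp f (ENNReal.ofReal r) μ →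
      ‖T ((𝓑.hull B \ 𝓑.hull A).indicator f) x‖ₑ ≤ ℓ * avg μ r f (𝓑.hull B)
  weak_type : ∀ f : X → 𝕜, MemLp f (ENNReal.ofReal r) μ → ∀ t : ℝ≥0, 0 < t →
    t * μ {x | t < ‖T f x‖ₑ} ^ (1 / r) ≤ ℓ * eLpNorm f (ENNReal.ofReal r) μ

variable {𝓑 : BallBasis μ K} {r : ℝ} {T : (X → 𝕜) → X → 𝕜} {ℓ : ℝ≥0}

namespace IsSubadditiveOp

variable (h : IsSubadditiveOp μ r T) {f g : X → 𝕜} {S S₁ S₂ : Set X}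
include h

lemma enorm_add_le (hf : MemLp f (ENNReal.ofReal r) μ) (hg : MemLp g (ENNReal.ofReal r) μ)
    (x : X) : ‖T (f + g) x‖ₑ ≤ ‖T f x‖ₑ + ‖T g x‖ₑ := by
  simp only [enorm_eq_nnnorm]
  exact_mod_cast h.2 f g hf hg x

lemma enorm_neg (hf : MemLp f (ENNReal.ofReal r) μ) (x : X) : ‖T (-f) x‖ₑ = ‖T f x‖ₑ := by
  have := h.1 f hf (-1) x
  simp only [neg_smul, one_smul, abs_neg, abs_one, one_mul] at this
  simp only [enorm_eq_nnnorm]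
  exact congrArg _ (NNReal.eq this)

/-- If `S₁` and `S₂` partition `S`, the three truncations of `f` satisfy the triangle inequality. -/
lemma enorm_indicator_le_add (hf : MemLp f (ENNReal.ofReal r) μ) (h₁ : MeasurableSet S₁)
    (h₂ : MeasurableSet S₂) (hd : Disjoint S₁ S₂) (hS : S = S₁ ∪ S₂) (x : X) :
    ‖T (S.indicator f) x‖ₑ ≤ ‖T (S₁.indicator f) x‖ₑ + ‖T (S₂.indicator f) x‖ₑ := by
  rw [hS, indicator_union_of_disjoint hd]
  exact h.enorm_add_le (hf.indicator h₁) (hf.indicator h₂) x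

lemma enorm_indicator_le_add' (hf : MemLp f (ENNReal.ofReal r) μ) (h₁ : MeasurableSet S₁)
    (h₂ : MeasurableSet S₂) (hd : Disjoint S₁ S₂) (hS : S = S₁ ∪ S₂) (x : X) :
    ‖T (S₁.indicator f) x‖ₑ ≤ ‖T (S.indicator f) x‖ₑ + ‖T (S₂.indicator f) x‖ₑ := by
  have : S₁.indicator f = S.indicator f + -S₂.indicator f := by
    rw [hS, indicator_union_of_disjoint hd]
    ext y
    simp
  rw [this, ← h.enorm_neg (hf.indicator h₂)]
  exact h.enorm_add_le (hf.indicator (hS ▸ h₁.union h₂)) (hf.indicator h₂).neg x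

end IsSubadditiveOp

lemma exists_mem_notMem_of_measure_lt {A S : Set X} (h : μ S < μ A) : ∃ x ∈ A, x ∉ S := by
  by_contra! hc
  exact absurd (measure_mono hc) (not_le.2 h)

namespace IsBOWith

variable (h : IsBOWith 𝓑 r T ℓ) {g : X → 𝕜} {m : ℝ≥0∞} {Λ : ℝ≥0} {A B D : Set X} {x : X}
include h

/-- The weak-type inequality at a level relative to a mean of the function. The factor `Λ` in place
of `Λ ^ r` makes it uniform in `r`. -/
lemma mul_measure_enorm_gt_le (hg : MemLp g (ENNReal.ofReal r) μ) (hm : m ≠ 0) (hm' : m ≠ ∞)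
    (hℓ : 0 < ℓ) (hΛ : 1 ≤ Λ) : Λ * μ {x | Λ * ℓ * mean μ r g m < ‖T g x‖ₑ} ≤ m := by
  have h0 : 0 < r := zero_lt_one.trans_le h.one_le
  by_cases ha : mean μ r g m = 0
  · have hz : μ {x | Λ * ℓ * mean μ r g m < ‖T g x‖ₑ} = 0 := by
      have hsub : {x | Λ * ℓ * mean μ r g m < ‖T g x‖ₑ} ⊆
          ⋃ n : ℕ, {x | (((n : ℝ≥0) + 1)⁻¹ : ℝ≥0) < ‖T g x‖ₑ} := by
        intro x hx
        simp only [ha, mul_zero, mem_ofPred_eq] at hx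
        obtain ⟨n, hn⟩ := ENNReal.exists_inv_nat_lt hx.ne'
        refine mem_iUnion.2 ⟨n, lt_of_le_of_lt ?_ hn⟩
        rw [ENNReal.coe_inv (by positivity)]
        push_cast
        exact ENNReal.inv_le_inv.2 le_self_add
      refine measure_mono_null hsub (measure_iUnion_null fun n => ?_)
      have ht : (0 : ℝ≥0) < ((n : ℝ≥0) + 1)⁻¹ := by positivity
      have := h.weak_type g hg _ ht
      rw [eLpNorm_eq_mean h.one_le hm hm', ha, zero_mul, mul_zero, nonpos_iff_eq_zero,
        mul_eq_zero] at this
      rcases this with h1 | h1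
      · exact absurd h1 (by exact_mod_cast ht.ne')
      · exact ((ENNReal.rpow_eq_zero_iff_of_pos (by positivity)).1 h1)
    rw [hz, mul_zero]
    exact zero_le
  · have hat := mean_ne_top h.one_le hg hm (m := m)
    have hΛ0 : (0 : ℝ≥0) < Λ := zero_lt_one.trans_le hΛ
    set a := (mean μ r g m).toNNReal with ha'
    have haa : mean μ r g m = a := (ENNReal.coe_toNNReal hat).symm
    have ha0 : 0 < a := by
      rw [pos_iff_ne_zero]
      rintro h1
      rw [h1] at haa
      exact ha (by simpa using haa)
    have h1 := h.weak_type g hg (Λ * ℓ * a) (by positivity)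
    rw [eLpNorm_eq_mean h.one_le hm hm', haa] at h1
    rw [haa]
    push_cast at h1
    set s := μ {x | (Λ : ℝ≥0∞) * ℓ * a < ‖T g x‖ₑ}
    have h2 : (Λ : ℝ≥0∞) * s ^ (1 / r) ≤ m ^ (1 / r) := by
      have hne : (ℓ * a : ℝ≥0∞) ≠ 0 := by
        have : 0 < ℓ * a := by positivity
        exact_mod_cast this.ne'
      refine (ENNReal.mul_le_mul_iff_right hne (by finiteness)).1 ?_
      calc _ = Λ * ℓ * a * s ^ (1 / r) := by ring
        _ ≤ _ := h1
        _ = _ := by ring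
    have h3 := (rpow_mul_le h.one_le hΛ s).trans h2
    exact (ENNReal.rpow_le_rpow_iff (by positivity)).1 h3

/-- Away from the hull of `A`, the function `T g` has size at most a multiple of the mean of `g` on
`A`, because it is small somewhere on `A` and oscillates little. -/
lemma enorm_compl_hull_le (hg : MemLp g (ENNReal.ofReal r) μ) (hℓ : 0 < ℓ) (hA : A ∈ 𝓑.balls)
    (hx : x ∈ A) : ‖T ((𝓑.hull A)ᶜ.indicator g) x‖ₑ ≤ 3 * ℓ * mean μ r g (μ A) := by
  have hg' := hg.indicator (𝓑.measurableSet_hull hA).compl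
  have hA0 := (𝓑.measure_pos A hA).ne'
  have hA1 := (𝓑.measure_lt_top A hA).ne
  have hw := h.mul_measure_enorm_gt_le hg' hA0 hA1 hℓ (Λ := 2) one_le_two
  obtain ⟨y, hyA, hy⟩ := exists_mem_notMem_of_measure_lt (μ := μ) (A := A)
    (S := {x | ((2 : ℝ≥0) : ℝ≥0∞) * ℓ * mean μ r ((𝓑.hull A)ᶜ.indicator g) (μ A) <
      ‖T ((𝓑.hull A)ᶜ.indicator g) x‖ₑ}) (by
        refine lt_of_le_of_lt ?_ (ENNReal.half_lt_self hA0 hA1)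
        rw [ENNReal.le_div_iff_mul_le (by simp) (by simp), mul_comm]
        simpa using hw)
  have hsub := (h.enorm_sub_le A hA x hx y hyA g hg).trans
    (mul_le_mul' le_rfl (avgStar_le_mean h.one_le))
  calc ‖T ((𝓑.hull A)ᶜ.indicator g) x‖ₑ
      ≤ ‖T ((𝓑.hull A)ᶜ.indicator g) x - T ((𝓑.hull A)ᶜ.indicator g) y‖ₑ
        + ‖T ((𝓑.hull A)ᶜ.indicator g) y‖ₑ := by
          simpa using enorm_add_le (T ((𝓑.hull A)ᶜ.indicator g) x -
            T ((𝓑.hull A)ᶜ.indicator g) y) (T ((𝓑.hull A)ᶜ.indicator g) y)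
    _ ≤ ℓ * mean μ r g (μ A) + 2 * ℓ * mean μ r g (μ A) := by
          gcongr
          refine (not_lt.1 hy).trans ?_
          rw [ENNReal.coe_ofNat]
          gcongr
          exact mean_indicator_le h.one_le
    _ = 3 * ℓ * mean μ r g (μ A) := by ring

/-- The preceding bound for a function carried by a set `D` of measure comparable to `μ A`. -/
lemma enorm_diff_hull_le (hg : MemLp g (ENNReal.ofReal r) μ) (hℓ : 0 < ℓ) (hA : A ∈ 𝓑.balls)
    (hD : MeasurableSet D) {c : ℝ≥0} (hc : 1 ≤ c) (hm : μ D ≤ c * μ A) (hx : x ∈ A) :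
    ‖T ((D \ 𝓑.hull A).indicator g) x‖ₑ ≤ 3 * c * ℓ * avg μ r g D := by
  have := h.enorm_compl_hull_le (hg.indicator hD) hℓ hA hx
  rw [indicator_indicator, inter_comm, ← sdiff_eq] at this
  calc _ ≤ _ := this
    _ ≤ 3 * ℓ * (c * avg μ r g D) := by
        gcongr
        rw [← mean_indicator h.one_le hD]
        exact mean_le_mul h.one_le hc hm
    _ = _ := by ring

end IsBOWith

end Operator

/-! ### Passing from a ball to a larger one -/

namespace IsBOWith

variable {X : Type*} [MeasurableSpace X] {𝕜 : Type*} [RCLike 𝕜] {μ : Measure X} {K : ℝ≥0}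
  {𝓑 : BallBasis μ K} {r : ℝ} {T : (X → 𝕜) → X → 𝕜} {ℓ : ℝ≥0}
  (h : IsBOWith 𝓑 r T ℓ) {g : X → 𝕜} {m : ℝ≥0∞} {Λ : ℝ≥0} {A B D : Set X} {x : X}
include h

/-- The connectivity condition for balls that grow geometrically. Among balls of comparable
measure, truncations are compared by `enorm_diff_hull_le`; the hypothesis on `T` enters only
when a scale gap separates the dilate of `A`, which is then its own hull, from all larger balls
around `A`. In the first alternative nothing remains to be done beyond `A`. -/
lemma exists_larger_ball (hℓ : 0 < ℓ) (hA : A ∈ 𝓑.balls) :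
    (∀ x ∈ A, ∀ g : X → 𝕜, MemLp g (ENNReal.ofReal r) μ →
      ‖T ((𝓑.hull A)ᶜ.indicator g) x‖ₑ ≤ 6 * K ^ 5 * ℓ * avg μ r g (𝓑.dilate (2 * K) A)) ∨
    ∃ B ∈ 𝓑.balls, A ⊆ B ∧ 2 * K * μ A ≤ μ B ∧ 𝓑.hull A ⊆ 𝓑.hull B ∧
      ∀ x ∈ A, ∀ g : X → 𝕜, MemLp g (ENNReal.ofReal r) μ →
        ‖T ((𝓑.hull B \ 𝓑.hull A).indicator g) x‖ₑ ≤
          6 * K ^ 5 * ℓ * (avg μ r g (𝓑.dilate (2 * K) A) + avg μ r g (𝓑.hull B)) := by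
  have hK : 1 ≤ K := 𝓑.one_le_const hA
  have hK2 : 1 ≤ 2 * K := hK.trans (le_mul_of_one_le_left' one_le_two)
  set N := 𝓑.dilate (2 * K) A
  have hN : N ∈ 𝓑.balls := 𝓑.dilate_mem hK2 hA
  have hAN : A ⊆ N := 𝓑.subset_dilate_self hK2 hA
  have hμN : μ N ≤ (2 * K ^ 3 : ℝ≥0) * μ A := by
    refine (𝓑.measure_dilate_le hK2 hA).trans_eq ?_
    push_cast; ring
  have hAne := 𝓑.nonempty_of_mem hA
  have hhA := 𝓑.hull_mem A hA
  have hAhN : 𝓑.hull A ⊆ N := by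
    refine 𝓑.subset_dilate hK2 hA hhA ((𝓑.measure_hull_le A hA).trans ?_)
      (hAne.mono (subset_inter (𝓑.subset_hull_self hA) Subset.rfl))
    push_cast
    gcongr
    exact le_mul_of_one_le_left' one_le_two
  have hNN : N ⊆ 𝓑.hull N := 𝓑.subset_hull_self hN
  have hhN := 𝓑.hull_mem N hN
  have hc (n : ℕ) : (1 : ℝ≥0) ≤ 2 * K ^ n :=
    (one_le_pow₀ hK).trans (le_mul_of_one_le_left' one_le_two)
  -- a ball of measure at most `2 K⁵ μ A` can be reached by `enorm_diff_hull_le`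
  have comparable (B : Set X) (hB : B ∈ 𝓑.balls) (hm : μ (𝓑.hull B) ≤ (2 * K ^ 5 : ℝ≥0) * μ A)
      (x : X) (hx : x ∈ A) (g : X → 𝕜) (hg : MemLp g (ENNReal.ofReal r) μ) :
      ‖T ((𝓑.hull B \ 𝓑.hull A).indicator g) x‖ₑ ≤
          6 * K ^ 5 * ℓ * (avg μ r g N + avg μ r g (𝓑.hull B)) := by
    refine (h.enorm_diff_hull_le hg hℓ hA (𝓑.measurableSet_hull hB) (hc 5) hm hx).trans ?_
    push_cast
    calc _ = 6 * K ^ 5 * ℓ * avg μ r g (𝓑.hull B) := by ring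
      _ ≤ _ := by gcongr; exact le_add_self
  have hhNm : μ (𝓑.hull N) ≤ (2 * K ^ 4 : ℝ≥0) * μ A := by
    refine (𝓑.measure_hull_le N hN).trans ((mul_le_mul' le_rfl hμN).trans_eq ?_)
    push_cast; ring
  rcases le_or_gt (2 * K * μ A) (μ N) with h1 | h1
  · refine Or.inr ⟨N, hN, hAN, h1, hAhN.trans hNN, comparable N hN (hhNm.trans ?_)⟩
    gcongr
    norm_num
  rcases le_or_gt (2 * K * μ A) (μ (𝓑.hull N)) with h2 | h2
  · refine Or.inr ⟨𝓑.hull N, hhN, hAN.trans hNN, h2,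
      hAhN.trans (hNN.trans (𝓑.subset_hull_self hhN)), comparable _ hhN ?_⟩
    refine (𝓑.measure_hull_le _ hhN).trans ((mul_le_mul' le_rfl hhNm).trans_eq ?_)
    push_cast; ring
  have hNeq : 𝓑.hull N = N := by
    refine Subset.antisymm (𝓑.subset_dilate hK2 hA hhN ?_ ?_) hNN
    · push_cast; exact h2.le
    · exact hAne.mono (subset_inter (hAN.trans hNN) Subset.rfl)
  have hcoef : (6 * K ^ 3 : ℝ≥0∞) ≤ 6 * K ^ 5 := by
    gcongr
    · exact_mod_cast hK
    · norm_num
  by_cases hu : N = univ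
  · refine Or.inl fun x hx g hg => ?_
    have := h.enorm_diff_hull_le hg hℓ hA (𝓑.measurableSet_ball N hN) (hc 3) hμN hx
    rw [hu, ← compl_eq_univ_sdiff] at this
    rw [hu]
    refine this.trans ?_
    push_cast
    calc _ = 6 * K ^ 3 * ℓ * avg μ r g univ := by ring
      _ ≤ _ := by gcongr
  · obtain ⟨B, hB, hNB, hTB⟩ := h.exists_ssuperset N hN (by rwa [hNeq])
    have hNhB : N ⊆ 𝓑.hull B := hNB.subset.trans (𝓑.subset_hull_self hB)
    refine Or.inr ⟨B, hB, hAN.trans hNB.subset, ?_, hAhN.trans hNhB, fun x hx g hg => ?_⟩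
    · by_contra! hlt
      refine hNB.not_subset (𝓑.subset_dilate hK2 hA hB ?_ ?_)
      · push_cast; exact hlt.le
      · exact hAne.mono (subset_inter (hAN.trans hNB.subset) Subset.rfl)
    · have hN' := 𝓑.measurableSet_ball N hN
      have hB' := 𝓑.measurableSet_hull hB
      have hA' := 𝓑.measurableSet_hull hA
      have e1 := h.subadditive.enorm_indicator_le_add hg (hN'.diff hA') (hB'.diff hN')
        (disjoint_sdiff_right.mono_left sdiff_subset)
        (S := 𝓑.hull B \ 𝓑.hull A) (by
          rw [union_comm, sdiff_union_sdiff_cancel hNhB hAhN]) x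
      have e2 := h.enorm_diff_hull_le hg hℓ hA hN' (hc 3) hμN hx
      have e3 := hTB x (hAN hx) g hg
      rw [hNeq] at e3
      refine e1.trans ((add_le_add e2 e3).trans ?_)
      have hcoef1 : (1 : ℝ≥0∞) ≤ 6 * K ^ 5 := by
        have : (1 : ℝ≥0) ≤ 6 * K ^ 5 :=
          (one_le_pow₀ hK).trans (le_mul_of_one_le_left' (by norm_num))
        exact_mod_cast this
      push_cast
      calc _ = 6 * K ^ 3 * (ℓ * avg μ r g N) + 1 * (ℓ * avg μ r g (𝓑.hull B)) := by ring
        _ ≤ 6 * K ^ 5 * (ℓ * avg μ r g N) + 6 * K ^ 5 * (ℓ * avg μ r g (𝓑.hull B)) := by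
          gcongr
        _ = _ := by ring

end IsBOWith

/-! ### Weak-type bounds for maximal operators -/

section Maximal

variable {X : Type*} [MeasurableSpace X] {𝕜 : Type*} [RCLike 𝕜] {μ : Measure X} {K : ℝ≥0}
  (𝓑 : BallBasis μ K) {r : ℝ} {T : (X → 𝕜) → X → 𝕜} {ℓ : ℝ≥0} {g : X → 𝕜} {m : ℝ≥0∞} {Λ : ℝ≥0}
  {D : Set X}

lemma lintegral_enorm_rpow_lt_top (hr : 1 ≤ r) (hg : MemLp g (ENNReal.ofReal r) μ) :
    ∫⁻ x, ‖g x‖ₑ ^ r ∂μ < ∞ := by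
  have h0 : 0 < r := zero_lt_one.trans_le hr
  have h := hg.2
  rwa [eLpNorm_eq_lintegral_rpow_enorm_toReal (by simpa using h0) (by simp),
    ENNReal.toReal_ofReal h0.le, ENNReal.rpow_lt_top_iff_of_pos (by positivity)] at h

/-- The set `{x | M_r g(x) > t}`, where `M_r g(x)` is the supremum of `⟨g⟩_{D,r}` over the balls
`D ∋ x`. -/
def BallBasis.maximalSet (r : ℝ) (g : X → 𝕜) (t : ℝ≥0∞) : Set X :=
  ⋃₀ {D ∈ 𝓑.balls | t < avg μ r g D}

lemma BallBasis.avg_le_of_notMem_maximalSet {t : ℝ≥0∞} {x : X} (hx : x ∉ 𝓑.maximalSet r g t)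
    (hD : D ∈ 𝓑.balls) (hxD : x ∈ D) : avg μ r g D ≤ t := by
  by_contra! hlt
  exact hx ⟨D, ⟨hD, hlt⟩, hxD⟩

lemma BallBasis.mul_measure_maximalSet_le (hr : 1 ≤ r) (hg : MemLp g (ENNReal.ofReal r) μ)
    (hm : m ≠ 0) (hm' : m ≠ ∞) (hΛ : 1 ≤ Λ) :
    Λ * μ (𝓑.maximalSet r g (Λ * mean μ r g m)) ≤ K * m := by
  have h0 : 0 < r := zero_lt_one.trans_le hr
  have hΛ0 : (Λ : ℝ≥0∞) ≠ 0 := by exact_mod_cast (zero_lt_one.trans_le hΛ).ne'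
  set I := ∫⁻ x, ‖g x‖ₑ ^ r ∂μ with hI
  have hIt : I ≠ ∞ := (lintegral_enorm_rpow_lt_top hr hg).ne
  have hlevel {D : Set X} (hD : Λ * mean μ r g m < avg μ r g D) :
      Λ * (I / m) < (∫⁻ x in D, ‖g x‖ₑ ^ r ∂μ) / μ D := by
    have := (rpow_mul_le hr hΛ (I / m)).trans_lt hD
    exact (ENNReal.rpow_lt_rpow_iff (by positivity)).1 this
  by_cases hI0 : I = 0
  · have : {D ∈ 𝓑.balls | Λ * mean μ r g m < avg μ r g D} = ∅ := by
      refine eq_empty_of_forall_notMem fun D hD => ?_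
      have h2 := hlevel hD.2
      have h3 : ∫⁻ x in D, ‖g x‖ₑ ^ r ∂μ = 0 :=
        le_antisymm ((lintegral_mono' Measure.restrict_le_self le_rfl).trans hI0.le) zero_le
      simp [h3] at h2
    simp [BallBasis.maximalSet, this]
  · set c : ℝ≥0∞ := (Λ * (I / m))⁻¹ with hc
    have hImt : I / m ≠ ∞ := ENNReal.div_ne_top hIt hm
    have hIm0 : I / m ≠ 0 := ENNReal.div_ne_zero.2 ⟨hI0, hm'⟩
    have hct : c ≠ ∞ := ENNReal.inv_ne_top.2 (mul_ne_zero hΛ0 hIm0)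
    have hfin : IsFiniteMeasure (c • μ.withDensity fun x => ‖g x‖ₑ ^ r) := by
      refine ⟨?_⟩
      rw [Measure.smul_apply, withDensity_apply _ MeasurableSet.univ, setLIntegral_univ]
      exact ENNReal.mul_lt_top hct.lt_top hIt.lt_top
    have hcov := 𝓑.measure_sUnion_le (𝒞 := {D ∈ 𝓑.balls | Λ * mean μ r g m < avg μ r g D})
      (sep_subset _ _) (c • μ.withDensity fun x => ‖g x‖ₑ ^ r) (by
        rintro D ⟨hD, hlt⟩
        have h2 := hlevel hlt
        rw [Measure.smul_apply, withDensity_apply _ (𝓑.measurableSet_ball D hD), smul_eq_mul, hc,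
          mul_comm, ← div_eq_mul_inv, ENNReal.le_div_iff_mul_le
            (Or.inl (mul_ne_zero hΛ0 hIm0)) (Or.inl (by finiteness)), mul_comm]
        exact (ENNReal.le_div_iff_mul_le (Or.inl (𝓑.measure_pos D hD).ne')
          (Or.inl (𝓑.measure_lt_top D hD).ne)).1 h2.le)
    rw [Measure.smul_apply, withDensity_apply _ MeasurableSet.univ, setLIntegral_univ,
      smul_eq_mul] at hcov
    calc Λ * μ (𝓑.maximalSet r g (Λ * mean μ r g m)) ≤ Λ * (K * (c * I)) := by
          gcongr; exact hcov
      _ = K * m := by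
          rw [hc, ENNReal.mul_inv (Or.inl hΛ0) (Or.inl ENNReal.coe_ne_top),
            ENNReal.inv_div (Or.inl hm') (Or.inl hm)]
          calc _ = K * (Λ * (Λ : ℝ≥0∞)⁻¹) * (m / I * I) := by ring
            _ = _ := by
              rw [ENNReal.mul_inv_cancel hΛ0 ENNReal.coe_ne_top, ENNReal.div_mul_cancel hI0 hIt,
                mul_one]

/-- A Cotlar-type inequality in weak form. If `x` lies in a ball `D` on which `|T g|` is mostly
small, compare the truncation at `x` with that at a point of `D` where both `|T g|` and
`|T (g 1_{D*})|` are small. The remaining balls are covered by the Vitali argument. -/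
lemma IsBOWith.mul_measure_maxTrunc_gt_le (h : IsBOWith 𝓑 r T ℓ)
    (hg : MemLp g (ENNReal.ofReal r) μ) (hm : m ≠ 0) (hm' : m ≠ ∞) (hℓ : 0 < ℓ) (hΛ : 1 ≤ Λ)
    (hK : 1 ≤ K) :
    Λ * μ {x | 6 * K * Λ * ℓ * mean μ r g m < maxTrunc 𝓑 T g x} ≤ 3 * K * m := by
  set a := mean μ r g m with ha
  set E := toMeasurable μ {x | Λ * ℓ * a < ‖T g x‖ₑ} with hE
  have hEm : MeasurableSet E := measurableSet_toMeasurable _ _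
  have hμE : Λ * μ E ≤ m := by
    rw [hE, measure_toMeasurable]
    exact h.mul_measure_enorm_gt_le hg hm hm' hℓ hΛ
  have hΛ0 : (Λ : ℝ≥0∞) ≠ 0 := by exact_mod_cast (zero_lt_one.trans_le hΛ).ne'
  have hEt : μ E ≠ ∞ := by
    intro htop
    rw [htop, ENNReal.mul_top hΛ0, top_le_iff] at hμE
    exact hm' hμE
  set 𝒞 : Set (Set X) := {D ∈ 𝓑.balls | μ D ≤ 2 * μ (D ∩ E)}
  have hfin : IsFiniteMeasure ((2 : ℝ≥0∞) • μ.restrict E) := by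
    refine ⟨?_⟩
    rw [Measure.smul_apply, Measure.restrict_apply_univ]
    exact ENNReal.mul_lt_top (by simp) hEt.lt_top
  have hcov := 𝓑.measure_sUnion_le (𝒞 := 𝒞) (sep_subset _ _) ((2 : ℝ≥0∞) • μ.restrict E) (by
    rintro D ⟨hD, hle⟩
    rwa [Measure.smul_apply, Measure.restrict_apply (𝓑.measurableSet_ball D hD)])
  rw [Measure.smul_apply, Measure.restrict_apply_univ, smul_eq_mul] at hcov
  have hsub : {x | 6 * K * Λ * ℓ * a < maxTrunc 𝓑 T g x} ⊆
      ⋃₀ 𝒞 ∪ 𝓑.maximalSet r g (Λ * a) := by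
    intro x hx
    by_contra hnot
    simp only [mem_union, not_or] at hnot
    refine (not_lt.2 ?_) (mem_ofPred.1 hx)
    refine (iSup₂_le fun D hD => iSup_le fun hxD => ?_)
    have hDE : 2 * μ (D ∩ E) < μ D := by
      by_contra! hle
      exact hnot.1 ⟨D, ⟨hD, hle⟩, hxD⟩
    have hmax : ∀ D' ∈ 𝓑.balls, D ⊆ D' → avg μ r g D' ≤ Λ * a := fun D' hD' hDD' =>
      𝓑.avg_le_of_notMem_maximalSet hnot.2 hD' (hDD' hxD)
    have hhD := 𝓑.hull_mem D hD
    have hDh := 𝓑.subset_hull_self hD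
    have hhDm := 𝓑.measurableSet_hull hD
    have hgD := hg.indicator hhDm
    set F := {y | ((4 * K : ℝ≥0) : ℝ≥0∞) * ℓ *
      mean μ r ((𝓑.hull D).indicator g) (μ (𝓑.hull D)) < ‖T ((𝓑.hull D).indicator g) y‖ₑ}
    have hF : ((4 * K : ℝ≥0) : ℝ≥0∞) * μ F ≤ K * μ D :=
      (h.mul_measure_enorm_gt_le hgD (𝓑.measure_pos _ hhD).ne' (𝓑.measure_lt_top _ hhD).ne hℓ
        (hK.trans (le_mul_of_one_le_left' (by norm_num)))).trans (𝓑.measure_hull_le D hD)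
    have hF' : 4 * μ F ≤ μ D := by
      have hK0 : (K : ℝ≥0∞) ≠ 0 := by exact_mod_cast (zero_lt_one.trans_le hK).ne'
      refine (ENNReal.mul_le_mul_iff_right hK0 ENNReal.coe_ne_top).1 ?_
      calc (K : ℝ≥0∞) * (4 * μ F) = ((4 * K : ℝ≥0) : ℝ≥0∞) * μ F := by push_cast; ring
        _ ≤ _ := hF
    obtain ⟨y, hyD, hy⟩ := exists_mem_notMem_of_measure_lt (μ := μ) (A := D)
      (S := (D ∩ E) ∪ F) (by
        have hlt : 4 * μ ((D ∩ E) ∪ F) < 4 * μ D := by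
          calc 4 * μ ((D ∩ E) ∪ F) ≤ 4 * (μ (D ∩ E) + μ F) := by
                gcongr; exact measure_union_le _ _
            _ = 2 * (2 * μ (D ∩ E)) + 4 * μ F := by ring
            _ ≤ 2 * (2 * μ (D ∩ E)) + μ D := by gcongr
            _ < 2 * μ D + μ D := by
                refine ENNReal.add_lt_add_right (𝓑.measure_lt_top D hD).ne ?_
                exact (ENNReal.mul_lt_mul_iff_right (by simp) (by simp)).2 hDE
            _ = 3 * μ D := by ring
            _ ≤ 4 * μ D := by gcongr; norm_num
        exact (ENNReal.mul_lt_mul_iff_right (by simp) (by simp)).1 hlt)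
    simp only [mem_union, not_or, mem_inter_iff, not_and] at hy
    have hyE : ‖T g y‖ₑ ≤ Λ * ℓ * a := by
      by_contra! hlt
      exact hy.1 hyD (subset_toMeasurable μ _ hlt)
    have hyF : ‖T ((𝓑.hull D).indicator g) y‖ₑ ≤ 4 * K * ℓ * (Λ * a) := by
      refine (not_lt.1 hy.2).trans ?_
      rw [mean_indicator h.one_le hhDm]
      push_cast
      gcongr
      exact hmax _ hhD hDh
    have e1 : ‖T ((𝓑.hull D)ᶜ.indicator g) y‖ₑ ≤ Λ * ℓ * a + 4 * K * ℓ * (Λ * a) := by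
      have := h.subadditive.enorm_indicator_le_add' hg hhDm.compl hhDm
        disjoint_compl_left (compl_union_self _).symm y
      rw [indicator_univ] at this
      exact this.trans (add_le_add hyE hyF)
    have e2 : ‖T ((𝓑.hull D)ᶜ.indicator g) x - T ((𝓑.hull D)ᶜ.indicator g) y‖ₑ ≤ ℓ * (Λ * a) := by
      refine (h.enorm_sub_le D hD x hxD y hyD g hg).trans ?_
      gcongr
      exact iSup₂_le fun D' hD' => iSup_le fun hDD' => hmax D' hD' hDD'
    calc ‖T ((𝓑.hull D)ᶜ.indicator g) x‖ₑ
        ≤ ‖T ((𝓑.hull D)ᶜ.indicator g) x - T ((𝓑.hull D)ᶜ.indicator g) y‖ₑ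
          + ‖T ((𝓑.hull D)ᶜ.indicator g) y‖ₑ := by
            simpa using enorm_add_le (T ((𝓑.hull D)ᶜ.indicator g) x -
              T ((𝓑.hull D)ᶜ.indicator g) y) (T ((𝓑.hull D)ᶜ.indicator g) y)
      _ ≤ ℓ * (Λ * a) + (Λ * ℓ * a + 4 * K * ℓ * (Λ * a)) := add_le_add e2 e1
      _ = (2 * 1 + 4 * K) * Λ * ℓ * a := by ring
      _ ≤ (2 * K + 4 * K) * Λ * ℓ * a := by
          gcongr
          exact_mod_cast hK
      _ = 6 * K * Λ * ℓ * a := by ring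
  calc Λ * μ {x | 6 * K * Λ * ℓ * a < maxTrunc 𝓑 T g x}
      ≤ Λ * (μ (⋃₀ 𝒞) + μ (𝓑.maximalSet r g (Λ * a))) := by
        gcongr
        exact (measure_mono hsub).trans (measure_union_le _ _)
    _ ≤ Λ * (K * (2 * μ E)) + Λ * μ (𝓑.maximalSet r g (Λ * a)) := by
        rw [mul_add]; gcongr
    _ ≤ 2 * K * (Λ * μ E) + K * m := by
        refine add_le_add (le_of_eq (by ring)) ?_
        exact 𝓑.mul_measure_maximalSet_le h.one_le hg hm hm' hΛ
    _ ≤ 2 * K * m + K * m := by gcongr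
    _ = 3 * K * m := by ring

end Maximal

/-! ### A stopping-time selection of balls -/

lemma exists_maximal_disjoint {X : Type*} {𝒞 : Set (Set X)} (h : ∀ D ∈ 𝒞, D.Nonempty) :
    ∃ u ⊆ 𝒞, u.PairwiseDisjoint id ∧ ∀ D ∈ 𝒞, ∃ R ∈ u, (D ∩ R).Nonempty := by
  obtain ⟨u, h1, h2, h3⟩ := Vitali.exists_disjoint_subfamily_covering_enlargement
    (fun D : Set X => D) 𝒞 (fun _ => 1) 2 one_lt_two (fun _ _ => zero_le_one) 1
    (fun _ _ => le_rfl) h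
  exact ⟨u, h1, h2, fun D hD => (h3 D hD).imp fun R hR => ⟨hR.1, hR.2.1⟩⟩

namespace BallBasis

variable {X : Type*} [MeasurableSpace X] {μ : Measure X} {K : ℝ≥0} (𝓑 : BallBasis μ K)
  {B D D' Q R : Set X} {F : Set X → Set X} {i j k n : ℕ} {x : X}

/-- The measure of `D` lies in the dyadic interval `(2^{-k-1} μ(B), 2^{-k} μ(B)]`. -/
def IsLevel (μ : Measure X) (B : Set X) (k : ℕ) (D : Set X) : Prop :=
  μ B < 2 ^ (k + 1) * μ D ∧ 2 ^ k * μ D ≤ μ B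

lemma IsLevel.measure_le_two_mul (h : IsLevel μ B i D) (h' : IsLevel μ B j D') (hij : i ≤ j) :
    μ D' ≤ 2 * μ D := by
  have : 2 ^ i * μ D' ≤ 2 ^ i * (2 * μ D) := by
    calc 2 ^ i * μ D' ≤ 2 ^ j * μ D' := by gcongr; norm_num
      _ ≤ 2 ^ (i + 1) * μ D := h'.2.trans h.1.le
      _ = 2 ^ i * (2 * μ D) := by ring
  exact (ENNReal.mul_le_mul_iff_right (by positivity) (by finiteness)).1 this

/-- Across `n + 1` levels the measure drops at least by the factor `2 ^ n`. -/
lemma IsLevel.pow_mul_measure_le (h : IsLevel μ B i D) (h' : IsLevel μ B j D')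
    (hij : i + n < j) : 2 ^ n * μ D' ≤ μ D := by
  have : 2 ^ (i + 1) * (2 ^ n * μ D') ≤ 2 ^ (i + 1) * μ D := by
    calc 2 ^ (i + 1) * (2 ^ n * μ D') = 2 ^ (i + n + 1) * μ D' := by ring
      _ ≤ 2 ^ j * μ D' := by gcongr; norm_num; exact hij
      _ ≤ 2 ^ (i + 1) * μ D := h'.2.trans h.1.le
  exact (ENNReal.mul_le_mul_iff_right (by positivity) (by finiteness)).1 this

lemma IsLevel.unique (h : IsLevel μ B i D) (h' : IsLevel μ B j D) : i = j := by
  wlog hij : i < j generalizing i j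
  · rcases (le_of_not_gt hij).eq_or_lt with h1 | h1
    exacts [h1.symm, (this h' h h1).symm]
  refine absurd (h.1.trans_le (le_trans ?_ h'.2)) (lt_irrefl _)
  gcongr
  · norm_num
  · exact hij

/-- Every ball with measure at most `μ B` has a level. -/
lemma exists_isLevel (hD0 : μ D ≠ 0) (hB : μ B ≠ ∞) (hD : μ D ≤ μ B) : ∃ k, IsLevel μ B k D := by
  classical
  have hex : ∃ k : ℕ, μ B < 2 ^ (k + 1) * μ D := by
    obtain ⟨n, hn⟩ := ENNReal.exists_nat_mul_gt hD0 hB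
    refine ⟨n, hn.trans_le ?_⟩
    gcongr
    calc (n : ℝ≥0∞) ≤ (2 ^ n : ℕ) := by exact_mod_cast Nat.lt_two_pow_self.le
      _ ≤ 2 ^ (n + 1) := by push_cast; gcongr <;> norm_num
  refine ⟨Nat.find hex, Nat.find_spec hex, ?_⟩
  rcases hk : Nat.find hex with _ | k
  · simpa using hD
  · exact not_lt.1 (Nat.find_min hex (m := k) (by omega))

variable (B F)

/-- The balls that compete at level `k`, when `q x` is the ball currently assigned to the point
`x`: those having a large part in the exceptional set `F (q x)` for some `x` in them. -/
def candidates (k : ℕ) (q : X → Set X) : Set (Set X) :=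
  {D ∈ 𝓑.balls | IsLevel μ B k D ∧ ∃ x ∈ D, x ∈ 𝓑.hull B ∧ μ D ≤ 4 * μ (D ∩ F (q x))}

lemma exists_picks (k : ℕ) (q : X → Set X) :
    ∃ u ⊆ 𝓑.candidates B F k q, u.PairwiseDisjoint id ∧
      ∀ D ∈ 𝓑.candidates B F k q, ∃ R ∈ u, (D ∩ R).Nonempty :=
  exists_maximal_disjoint fun _ hD => 𝓑.nonempty_of_mem hD.1

open Classical in
/-- The balls are selected level by level, in order of decreasing measure. The first component is
the family of balls selected at level `k`, a maximal disjoint family of candidates; the second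
assigns to each point a selected ball of level at most `k` whose hull contains it, which is replaced
as soon as the hull of a newly selected ball contains the point. -/
noncomputable def selection : ℕ → Set (Set X) × (X → Set X)
  | 0 => ({B}, fun _ => B)
  | k + 1 =>
    let u := (𝓑.exists_picks B F (k + 1) (selection k).2).choose
    (u, fun x => if h : ∃ R ∈ u, x ∈ 𝓑.hull R then h.choose else (selection k).2 x)

/-- The balls selected at level `k`. -/
noncomputable def picks (k : ℕ) : Set (Set X) := (𝓑.selection B F k).1

/-- The ball assigned to `x` when the levels up to `k` have been processed. -/
noncomputable def current (k : ℕ) (x : X) : Set X := (𝓑.selection B F k).2 x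

lemma picks_zero : 𝓑.picks B F 0 = {B} := rfl

lemma current_zero : 𝓑.current B F 0 x = B := rfl

lemma picks_succ_spec (k : ℕ) :
    𝓑.picks B F (k + 1) ⊆ 𝓑.candidates B F (k + 1) (𝓑.current B F k) ∧
      (𝓑.picks B F (k + 1)).PairwiseDisjoint id ∧
      ∀ D ∈ 𝓑.candidates B F (k + 1) (𝓑.current B F k),
        ∃ R ∈ 𝓑.picks B F (k + 1), (D ∩ R).Nonempty :=
  (𝓑.exists_picks B F (k + 1) (𝓑.selection B F k).2).choose_spec

lemma current_succ_of_exists (h : ∃ R ∈ 𝓑.picks B F (k + 1), x ∈ 𝓑.hull R) :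
    𝓑.current B F (k + 1) x ∈ 𝓑.picks B F (k + 1) ∧ x ∈ 𝓑.hull (𝓑.current B F (k + 1) x) := by
  classical
  have : 𝓑.current B F (k + 1) x = h.choose := dif_pos h
  rw [this]
  exact h.choose_spec

lemma current_succ_of_not_exists (h : ¬ ∃ R ∈ 𝓑.picks B F (k + 1), x ∈ 𝓑.hull R) :
    𝓑.current B F (k + 1) x = 𝓑.current B F k x := by
  classical
  exact dif_neg h

/-- The balls selected at levels up to `k`. -/
def picksUpTo (k : ℕ) : Set (Set X) := {R | ∃ i ≤ k, R ∈ 𝓑.picks B F i}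

variable {B F}
variable (hB : B ∈ 𝓑.balls)
include hB

lemma mem_balls_of_mem_picks (hR : R ∈ 𝓑.picks B F k) : R ∈ 𝓑.balls := by
  cases k with
  | zero => rw [picks_zero, mem_singleton_iff] at hR; exact hR ▸ hB
  | succ k => exact ((𝓑.picks_succ_spec B F k).1 hR).1

lemma isLevel_of_mem_picks (hR : R ∈ 𝓑.picks B F k) : IsLevel μ B k R := by
  cases k with
  | zero =>
    rw [picks_zero, mem_singleton_iff] at hR
    have := ENNReal.mul_lt_mul_left (𝓑.measure_pos B hB).ne' (𝓑.measure_lt_top B hB).ne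
      ENNReal.one_lt_two
    exact ⟨by simpa [hR] using this, by simp [hR]⟩
  | succ k => exact ((𝓑.picks_succ_spec B F k).1 hR).2.1

omit hB in
lemma pairwiseDisjoint_picks (k : ℕ) : (𝓑.picks B F k).PairwiseDisjoint id := by
  cases k with
  | zero => rw [picks_zero]; exact pairwiseDisjoint_singleton _ _
  | succ k => exact (𝓑.picks_succ_spec B F k).2.1

omit hB in
lemma current_mem (hx : x ∈ 𝓑.hull B) (k : ℕ) :
    𝓑.current B F k x ∈ 𝓑.picksUpTo B F k ∧ x ∈ 𝓑.hull (𝓑.current B F k x) := by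
  induction k with
  | zero => exact ⟨⟨0, le_rfl, rfl⟩, hx⟩
  | succ k ih =>
    by_cases h : ∃ R ∈ 𝓑.picks B F (k + 1), x ∈ 𝓑.hull R
    · have := 𝓑.current_succ_of_exists B F h
      exact ⟨⟨k + 1, le_rfl, this.1⟩, this.2⟩
    · rw [𝓑.current_succ_of_not_exists B F h]
      exact ⟨ih.1.imp fun i hi => ⟨hi.1.trans k.le_succ, hi.2⟩, ih.2⟩

omit hB in
/-- Once a ball of level `j` has been selected, the points of its hull are assigned balls of level
at least `j`. -/
lemma le_level_current (hR : R ∈ 𝓑.picks B F j) (hx : x ∈ 𝓑.hull R) (hjk : j ≤ k) :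
    ∃ i, j ≤ i ∧ i ≤ k ∧ 𝓑.current B F k x ∈ 𝓑.picks B F i := by
  induction k, hjk using Nat.le_induction with
  | base =>
    cases j with
    | zero => exact ⟨0, le_rfl, le_rfl, rfl⟩
    | succ j => exact ⟨j + 1, le_rfl, le_rfl, (𝓑.current_succ_of_exists B F ⟨R, hR, hx⟩).1⟩
  | succ k hk ih =>
    by_cases h : ∃ R ∈ 𝓑.picks B F (k + 1), x ∈ 𝓑.hull R
    · exact ⟨k + 1, by omega, le_rfl, (𝓑.current_succ_of_exists B F h).1⟩
    · rw [𝓑.current_succ_of_not_exists B F h]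
      obtain ⟨i, h1, h2, h3⟩ := ih
      exact ⟨i, h1, by omega, h3⟩

variable {ε : ℝ≥0} (hF : ∀ P ∈ 𝓑.balls, μ (F P) ≤ ε * μ P)
include hF

/-- A ball around `x` of level at most `k` meets the exceptional set of the ball currently assigned
to `x` in a small part only; otherwise it would have been a candidate, so that the hull of a
selected ball of the same level would contain `x`. -/
lemma four_mul_measure_inter_lt (hε : 16 * ε ≤ 1) (hx : x ∈ 𝓑.hull B) (hD : D ∈ 𝓑.balls)
    (hxD : x ∈ D) (hk : μ B < 2 ^ (k + 1) * μ D) :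
    4 * μ (D ∩ F (𝓑.current B F k x)) < μ D := by
  have hD0 := (𝓑.measure_pos D hD).ne'
  have hD1 := (𝓑.measure_lt_top D hD).ne
  -- the case in which the current ball has level `k`
  have key {P : Set X} {k : ℕ} (hP : P ∈ 𝓑.picks B F k) (hk : μ B < 2 ^ (k + 1) * μ D) :
      4 * μ (D ∩ F P) < μ D := by
    have hPD : μ P ≤ 2 * μ D := by
      have : 2 ^ k * μ P ≤ 2 ^ k * (2 * μ D) := by
        refine ((𝓑.isLevel_of_mem_picks hB hP).2.trans hk.le).trans_eq ?_
        ring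
      exact (ENNReal.mul_le_mul_iff_right (by positivity) (by finiteness)).1 this
    have hε' : (16 : ℝ≥0∞) * ε ≤ 1 := by exact_mod_cast hε
    have h2 : 2 * (4 * μ (D ∩ F P)) < 2 * μ D := by
      calc 2 * (4 * μ (D ∩ F P)) ≤ 2 * (4 * (ε * (2 * μ D))) := by
            gcongr
            exact (measure_mono inter_subset_right).trans
              ((hF P (𝓑.mem_balls_of_mem_picks hB hP)).trans (by gcongr))
        _ = (16 * ε) * μ D := by ring
        _ ≤ 1 * μ D := by gcongr
        _ < 2 * μ D := ENNReal.mul_lt_mul_left hD0 hD1 ENNReal.one_lt_two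
    exact (ENNReal.mul_lt_mul_iff_right (by simp) (by simp)).1 h2
  induction k with
  | zero => exact key (k := 0) (P := B) rfl hk
  | succ k ih =>
    by_cases h : ∃ R ∈ 𝓑.picks B F (k + 1), x ∈ 𝓑.hull R
    · exact key (𝓑.current_succ_of_exists B F h).1 hk
    · rw [𝓑.current_succ_of_not_exists B F h]
      by_cases hk' : μ B < 2 ^ (k + 1) * μ D
      · exact ih hk'
      · by_contra! hle
        have hlev : IsLevel μ B (k + 1) D := ⟨hk, not_lt.1 hk'⟩
        obtain ⟨R, hR, hDR⟩ := (𝓑.picks_succ_spec B F k).2.2 D ⟨hD, hlev, x, hxD, hx, hle⟩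
        refine h ⟨R, hR, 𝓑.subset_hull R (𝓑.mem_balls_of_mem_picks hB hR) D hD ?_ hDR hxD⟩
        exact (𝓑.isLevel_of_mem_picks hB hR).measure_le_two_mul hlev le_rfl

omit hB hF in
lemma exists_parent (hR : R ∈ 𝓑.picks B F (n + 1)) :
    ∃ P ∈ 𝓑.picksUpTo B F n, μ R ≤ 4 * μ (R ∩ F P) ∧
      ∃ x ∈ R, x ∈ 𝓑.hull P ∧ 𝓑.current B F n x = P := by
  obtain ⟨-, -, x, hxR, hxB, hle⟩ := (𝓑.picks_succ_spec B F n).1 hR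
  have := 𝓑.current_mem (F := F) hxB n
  exact ⟨_, this.1, hle, x, hxR, this.2, rfl⟩

open Classical in
omit hB hF in
variable (B F) in
/-- The parent of a selected ball `R` is the ball assigned, just before the selection of `R`, to a
point of `R` on account of which `R` was a candidate. The value at other sets is junk. -/
noncomputable def parent (R : Set X) : Set X :=
  if h : ∃ P n, R ∈ 𝓑.picks B F (n + 1) ∧ P ∈ 𝓑.picksUpTo B F n ∧ μ R ≤ 4 * μ (R ∩ F P) ∧
      ∃ x ∈ R, x ∈ 𝓑.hull P ∧ 𝓑.current B F n x = P then h.choose else R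

omit hF in
lemma parent_spec (hR : R ∈ 𝓑.picks B F (n + 1)) :
    𝓑.parent B F R ∈ 𝓑.picksUpTo B F n ∧ μ R ≤ 4 * μ (R ∩ F (𝓑.parent B F R)) ∧
      ∃ x ∈ R, x ∈ 𝓑.hull (𝓑.parent B F R) ∧ 𝓑.current B F n x = 𝓑.parent B F R := by
  classical
  have h : ∃ P n, R ∈ 𝓑.picks B F (n + 1) ∧ P ∈ 𝓑.picksUpTo B F n ∧ μ R ≤ 4 * μ (R ∩ F P) ∧
      ∃ x ∈ R, x ∈ 𝓑.hull P ∧ 𝓑.current B F n x = P :=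
    let ⟨P, hP⟩ := 𝓑.exists_parent hR
    ⟨P, n, hR, hP⟩
  rw [parent, dif_pos h]
  obtain ⟨n', hn', hspec⟩ := h.choose_spec
  have hn : n' = n := by
    have := (𝓑.isLevel_of_mem_picks hB hn').unique (𝓑.isLevel_of_mem_picks hB hR)
    omega
  exact hn ▸ hspec

omit hF in
lemma mem_balls_of_mem_picksUpTo (hR : R ∈ 𝓑.picksUpTo B F n) : R ∈ 𝓑.balls :=
  let ⟨_, _, h⟩ := hR
  𝓑.mem_balls_of_mem_picks hB h

omit hF in
/-- Two selected balls with the same parent are disjoint: the smaller one could not have met the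
larger one, because its points would have been assigned a ball of higher level. -/
lemma disjoint_of_parent_eq (hR : R ∈ 𝓑.picks B F (n + 1)) (hQ : Q ∈ 𝓑.picks B F (k + 1))
    (hne : R ≠ Q) (hp : 𝓑.parent B F R = 𝓑.parent B F Q) : Disjoint R Q := by
  wlog hnk : n ≤ k generalizing n k R Q
  · exact (this hQ hR hne.symm hp.symm (by omega)).symm
  rcases hnk.eq_or_lt with rfl | hlt
  · exact 𝓑.pairwiseDisjoint_picks (n + 1) hR hQ hne
  by_contra hd
  rw [not_disjoint_iff_nonempty_inter, inter_comm] at hd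
  have hsub : Q ⊆ 𝓑.hull R := 𝓑.subset_hull R (𝓑.mem_balls_of_mem_picks hB hR) Q
    (𝓑.mem_balls_of_mem_picks hB hQ)
    ((𝓑.isLevel_of_mem_picks hB hR).measure_le_two_mul (𝓑.isLevel_of_mem_picks hB hQ) (by omega))
    hd
  obtain ⟨-, -, x, hxQ, -, hx⟩ := 𝓑.parent_spec hB hQ
  obtain ⟨i, hi, -, hi'⟩ := 𝓑.le_level_current hR (hsub hxQ) (show n + 1 ≤ k by omega)
  obtain ⟨j, hj, hj'⟩ := (𝓑.parent_spec hB hR).1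
  rw [hx, ← hp] at hi'
  have := (𝓑.isLevel_of_mem_picks hB hi').unique (𝓑.isLevel_of_mem_picks hB hj')
  omega

/-- The children of a ball `P` fill out a small part of it in measure, since each of them has a
quarter of its measure in the exceptional set of `P`. -/
lemma tsum_children_le {𝒟 𝒟' : Set (Set X)} (hFm : ∀ P ∈ 𝓑.balls, MeasurableSet (F P))
    (h𝒟 : ∀ R ∈ 𝒟, ∃ n, R ∈ 𝓑.picks B F (n + 1)) (h𝒟' : 𝒟' ⊆ 𝓑.balls)
    (hp : ∀ R ∈ 𝒟, 𝓑.parent B F R ∈ 𝒟') :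
    ∑' R : 𝒟, μ R ≤ 4 * ε * ∑' P : 𝒟', μ P := by
  let p : 𝒟 → 𝒟' := fun R => ⟨𝓑.parent B F R, hp R R.2⟩
  calc ∑' R : 𝒟, μ R ≤ ∑' R : 𝒟, 4 * μ ((R : Set X) ∩ F (p R)) := by
        gcongr with R
        obtain ⟨n, hn⟩ := h𝒟 R R.2
        exact (𝓑.parent_spec hB hn).2.1
    _ = ∑' P : 𝒟', ∑' R : p ⁻¹' {P}, 4 * μ ((R : Set X) ∩ F (p R)) :=
        (ENNReal.tsum_fiberwise (fun R : 𝒟 => 4 * μ ((R : Set X) ∩ F (p R))) p).symm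
    _ ≤ ∑' P : 𝒟', 4 * (ε * μ P) := by
        gcongr with P
        rw [ENNReal.tsum_mul_left]
        gcongr
        have hP := h𝒟' P.2
        calc ∑' R : p ⁻¹' {P}, μ (((R : 𝒟) : Set X) ∩ F (p R))
            = ∑' R : p ⁻¹' {P}, μ (((R : 𝒟) : Set X) ∩ F P) := by
              congr 1 with R
              rw [show p R = P from R.2]
          _ ≤ μ (⋃ R : p ⁻¹' {P}, ((R : 𝒟) : Set X) ∩ F P) := by
              refine tsum_meas_le_meas_iUnion_of_disjoint μ (fun R => ?_) (fun R R' hne => ?_)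
              · obtain ⟨n, hn⟩ := h𝒟 R R.1.2
                exact (𝓑.measurableSet_ball _ (𝓑.mem_balls_of_mem_picks hB hn)).inter (hFm _ hP)
              · obtain ⟨n, hn⟩ := h𝒟 R R.1.2
                obtain ⟨n', hn'⟩ := h𝒟 R' R'.1.2
                refine (𝓑.disjoint_of_parent_eq hB hn hn' ?_ ?_).mono inter_subset_left
                  inter_subset_left
                · exact fun h => hne (Subtype.ext (Subtype.ext h))
                · exact congrArg Subtype.val (R.2.trans R'.2.symm)
          _ ≤ μ (F P) := measure_mono (iUnion_subset fun _ => inter_subset_right)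
          _ ≤ ε * μ P := hF P hP
    _ = 4 * ε * ∑' P : 𝒟', μ P := by
        rw [← ENNReal.tsum_mul_left]
        congr 1 with P
        ring

/-- A family of selected balls that contains the parents of its members of level above `j` has most
of its mass at levels up to `j`: the masses of successive generations decay geometrically. -/
lemma tsum_level_gt_le {𝒟 : Set (Set X)} (hFm : ∀ P ∈ 𝓑.balls, MeasurableSet (F P))
    (hε : 8 * ε ≤ 1) (j : ℕ)
    (h𝒟 : ∀ i, j < i → ∀ R ∈ 𝒟, R ∈ 𝓑.picks B F i → 𝓑.parent B F R ∈ 𝒟) (n : ℕ) :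
    ∑' R : {R ∈ 𝒟 | ∃ i, j < i ∧ i ≤ n ∧ R ∈ 𝓑.picks B F i}, μ (R : Set X) ≤
      8 * ε * ∑' R : (𝒟 ∩ 𝓑.picksUpTo B F j : Set (Set X)), μ (R : Set X) := by
  have hε' : (8 * ε : ℝ≥0∞) ≤ 1 := by exact_mod_cast hε
  induction n with
  | zero =>
    have : {R ∈ 𝒟 | ∃ i, j < i ∧ i ≤ 0 ∧ R ∈ 𝓑.picks B F i} = ∅ :=
      eq_empty_of_forall_notMem fun R ⟨_, i, h1, h2, _⟩ => by omega
    rw [this]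
    simp
  | succ n ih =>
    set 𝒜 := 𝒟 ∩ 𝓑.picksUpTo B F j
    set 𝒜' := {R ∈ 𝒟 | ∃ i, j < i ∧ i ≤ n ∧ R ∈ 𝓑.picks B F i}
    have hstep := 𝓑.tsum_children_le hB hF (𝒟' := 𝒜 ∪ 𝒜')
      (𝒟 := {R ∈ 𝒟 | ∃ i, j < i ∧ i ≤ n + 1 ∧ R ∈ 𝓑.picks B F i}) hFm
      (by
        rintro R ⟨-, i, h1, -, h2⟩
        exact ⟨i - 1, by rwa [Nat.sub_add_cancel (by omega)]⟩)
      (by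
        rintro R (⟨-, i, -, h⟩ | ⟨-, i, -, -, h⟩) <;> exact 𝓑.mem_balls_of_mem_picks hB h)
      (by
        rintro R ⟨hR, i, h1, h2, h3⟩
        have hp := h𝒟 i h1 R hR h3
        obtain ⟨i, rfl⟩ : ∃ i', i = i' + 1 := ⟨i - 1, by omega⟩
        obtain ⟨l, hl, hl'⟩ := (𝓑.parent_spec hB h3).1
        rcases le_or_gt l j with hlj | hlj
        · exact Or.inl ⟨hp, l, hlj, hl'⟩
        · exact Or.inr ⟨hp, l, hlj, by omega, hl'⟩)
    calc _ ≤ _ := hstep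
      _ ≤ 4 * ε * (∑' R : 𝒜, μ R + ∑' R : 𝒜', μ R) := by
          gcongr
          exact ENNReal.tsum_union_le (fun R : Set X => μ R) 𝒜 𝒜'
      _ ≤ 4 * ε * (∑' R : 𝒜, μ R + 1 * ∑' R : 𝒜, μ R) := by
          gcongr
          exact ih.trans (by gcongr)
      _ = 8 * ε * ∑' R : 𝒜, μ R := by ring

end BallBasis

namespace BallBasis

variable {X : Type*} [MeasurableSpace X] {μ : Measure X} {K : ℝ≥0} (𝓑 : BallBasis μ K)
  {B Q R : Set X} {F : Set X → Set X} {i j k n : ℕ} {x : X} {ε : ℝ≥0}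
  (hB : B ∈ 𝓑.balls) (hF : ∀ P ∈ 𝓑.balls, μ (F P) ≤ ε * μ P)

include hB in
lemma measurableSet_picks (hR : R ∈ 𝓑.picks B F k) : MeasurableSet R :=
  𝓑.measurableSet_ball _ (𝓑.mem_balls_of_mem_picks hB hR)

include hB in
lemma tsum_picks_le {𝒟 : Set (Set X)} (h𝒟 : 𝒟 ⊆ 𝓑.picks B F k) {S : Set X}
    (hS : ∀ R ∈ 𝒟, R ⊆ S) : ∑' R : 𝒟, μ R ≤ μ S := by
  refine (tsum_meas_le_meas_iUnion_of_disjoint μ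
    (fun R => 𝓑.measurableSet_picks hB (h𝒟 R.2)) (fun R R' hne => ?_)).trans
    (measure_mono (iUnion_subset fun R => hS R R.2))
  exact 𝓑.pairwiseDisjoint_picks k (h𝒟 R.2) (h𝒟 R'.2) fun h => hne (Subtype.ext h)

include hB in
lemma countable_of_tsum_ne_top {𝒟 : Set (Set X)} (h𝒟 : ∀ R ∈ 𝒟, ∃ k, R ∈ 𝓑.picks B F k)
    (h : ∑' R : 𝒟, μ R ≠ ∞) : 𝒟.Countable := by
  have h1 := Summable.countable_support_ennreal h
  have h2 : Function.support (fun R : 𝒟 => μ (R : Set X)) = univ := eq_univ_of_forall fun R =>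
    let ⟨_, hk⟩ := h𝒟 R R.2
    (𝓑.measure_pos _ (𝓑.mem_balls_of_mem_picks hB hk)).ne'
  rw [h2, countable_univ_iff] at h1
  exact countable_coe_iff.1 h1

include hB hF

lemma countable_picks (hFm : ∀ P ∈ 𝓑.balls, MeasurableSet (F P)) (hε : 8 * ε ≤ 1) (k : ℕ) :
    (𝓑.picks B F k).Countable := by
  cases k with
  | zero => rw [picks_zero]; exact countable_singleton B
  | succ k =>
    have h := 𝓑.tsum_level_gt_le hB hF (𝒟 := {R | ∃ i, R ∈ 𝓑.picks B F i}) hFm hε 0 (by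
      rintro i hi R - hR
      obtain ⟨i, rfl⟩ : ∃ i', i = i' + 1 := ⟨i - 1, by omega⟩
      obtain ⟨l, -, hl⟩ := (𝓑.parent_spec hB hR).1
      exact ⟨l, hl⟩) (k + 1)
    have h0 : ∑' R : ({R | ∃ i, R ∈ 𝓑.picks B F i} ∩ 𝓑.picksUpTo B F 0 : Set (Set X)),
        μ (R : Set X) ≤ μ B := by
      refine 𝓑.tsum_picks_le hB (F := F) (k := 0) ?_ ?_
      · rintro R ⟨-, i, hi, hR⟩
        rwa [Nat.le_zero.1 hi] at hR
      · rintro R ⟨-, i, hi, hR⟩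
        rw [Nat.le_zero.1 hi, picks_zero] at hR
        exact (mem_singleton_iff.1 hR).subset
    refine Countable.mono ?_ (𝓑.countable_of_tsum_ne_top (F := F) hB ?_ (ne_top_of_le_ne_top ?_ h))
    · exact fun R hR => ⟨⟨_, hR⟩, k + 1, k.succ_pos, le_rfl, hR⟩
    · rintro R ⟨-, i, -, -, h⟩
      exact ⟨i, h⟩
    · have := 𝓑.measure_lt_top B hB
      exact ENNReal.mul_ne_top (by finiteness) (h0.trans_lt this).ne

omit hF in
/-- The double hull of a selected ball is contained in that of its parent; hence the double hull of
a selected ball contains all its descendants. -/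
lemma hull_hull_subset_parent (hF : ∀ P ∈ 𝓑.balls, μ (F P) ≤ ε * μ P)
    (hKε : 2 * K ^ 2 * ε ≤ 1) (hR : R ∈ 𝓑.picks B F (n + 1)) :
    𝓑.hull (𝓑.hull R) ⊆ 𝓑.hull (𝓑.hull (𝓑.parent B F R)) := by
  obtain ⟨hP, hle, x, hxR, hxP, -⟩ := 𝓑.parent_spec hB hR
  have hPb := 𝓑.mem_balls_of_mem_picksUpTo hB hP
  have hRb := 𝓑.mem_balls_of_mem_picks hB hR
  set P := 𝓑.parent B F R
  refine 𝓑.subset_hull _ (𝓑.hull_mem _ hPb) _ (𝓑.hull_mem _ (𝓑.hull_mem _ hRb)) ?_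
    ⟨x, 𝓑.subset_hull_self (𝓑.hull_mem _ hRb) (𝓑.subset_hull_self hRb hxR), hxP⟩
  have hKε' : (2 * K ^ 2 * ε : ℝ≥0∞) ≤ 1 := by exact_mod_cast hKε
  calc μ (𝓑.hull (𝓑.hull R)) ≤ K ^ 2 * μ R := 𝓑.measure_hull_hull_le hRb
    _ ≤ K ^ 2 * (4 * (ε * μ P)) := by
        gcongr
        exact hle.trans (by gcongr; exact (measure_mono inter_subset_right).trans (hF P hPb))
    _ = 2 * (2 * K ^ 2 * ε) * μ P := by ring
    _ ≤ 2 * 1 * μ P := by gcongr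
    _ ≤ 2 * μ (𝓑.hull P) := by rw [mul_one]; gcongr; exact 𝓑.subset_hull_self hPb

/-- A selected ball `Q` of level `j` that is met by a later ball `R` of level at most `j + c` would
be comparable to `R`; but `R` lies in the hull of `Q`, so its parent has level at least `j` and `R`
is much smaller than `Q`. -/
lemma lt_level_of_inter_nonempty {c : ℕ} (hε : 2 ^ (c + 4) * ε ≤ 1) (hQ : Q ∈ 𝓑.picks B F j)
    (hR : R ∈ 𝓑.picks B F i) (hji : j < i) (hRQ : (R ∩ Q).Nonempty) : j + c < i := by
  by_contra! hic
  obtain ⟨n, rfl⟩ : ∃ n, i = n + 1 := ⟨i - 1, by omega⟩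
  have hQb := 𝓑.mem_balls_of_mem_picks hB hQ
  have hRb := 𝓑.mem_balls_of_mem_picks hB hR
  have hQl := 𝓑.isLevel_of_mem_picks hB hQ
  have hRl := 𝓑.isLevel_of_mem_picks hB hR
  have hsub : R ⊆ 𝓑.hull Q :=
    𝓑.subset_hull Q hQb R hRb (hQl.measure_le_two_mul hRl hji.le) hRQ
  obtain ⟨hP, hle, x, hxR, hxP, hx⟩ := 𝓑.parent_spec hB hR
  obtain ⟨l, hl, hln, hPl⟩ := 𝓑.le_level_current hQ (hsub hxR) (show j ≤ n by omega)
  rw [hx] at hPl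
  set P := 𝓑.parent B F R
  have hPb := 𝓑.mem_balls_of_mem_picks hB hPl
  have h1 : μ R ≤ 8 * ε * μ Q := by
    calc μ R ≤ 4 * (ε * μ P) :=
          hle.trans (by gcongr; exact (measure_mono inter_subset_right).trans (hF P hPb))
      _ ≤ 4 * (ε * (2 * μ Q)) := by
          gcongr
          exact hQl.measure_le_two_mul (𝓑.isLevel_of_mem_picks hB hPl) hl
      _ = 8 * ε * μ Q := by ring
  have hε' : (2 ^ (c + 4) * ε : ℝ≥0∞) ≤ 1 := by exact_mod_cast hε
  refine absurd (hRl.1.trans_le ?_) (lt_irrefl _)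
  calc 2 ^ (n + 1 + 1) * μ R ≤ 2 ^ (j + c + 1) * (8 * ε * μ Q) := by gcongr; norm_num
    _ = 2 ^ j * μ Q * (2 ^ (c + 4) * ε) := by ring
    _ ≤ 2 ^ j * μ Q * 1 := by gcongr
    _ ≤ μ B := by rw [mul_one]; exact hQl.2

/-- The balls selected after `Q` cover at most half of `Q`. They descend from selected balls that
are near `Q` and comparable to it, and there the masses of the generations decay geometrically. -/
lemma measure_inter_later_le {c : ℕ} (hFm : ∀ P ∈ 𝓑.balls, MeasurableSet (F P))
    (hc : K ^ 2 ≤ 2 ^ c) (hε : 2 ^ (c + 5) * (c + 1) * K ^ 4 * ε ≤ 1) (hQ : Q ∈ 𝓑.picks B F j) :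
    2 * μ (Q ∩ ⋃ i > j, ⋃₀ 𝓑.picks B F i) ≤ μ Q := by
  have hK : 1 ≤ K := 𝓑.one_le_const hB
  have hc1 : (1 : ℝ≥0) ≤ c + 1 := le_add_self
  have hε1 : 2 ^ (c + 5) * ε ≤ 1 := by
    refine le_trans ?_ hε
    calc 2 ^ (c + 5) * ε = 2 ^ (c + 5) * 1 * 1 * ε := by ring
      _ ≤ _ := by gcongr; exact one_le_pow₀ hK
  have hε8 : 8 * ε ≤ 1 := by
    refine le_trans ?_ hε1
    gcongr
    calc (8 : ℝ≥0) = 2 ^ 3 := by norm_num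
      _ ≤ _ := pow_le_pow_right₀ one_le_two (by omega)
  have hε4 : 2 ^ (c + 4) * ε ≤ 1 := by
    refine le_trans ?_ hε1
    gcongr <;> norm_num
  have hK2ε : 2 * K ^ 2 * ε ≤ 1 := by
    refine le_trans ?_ hε
    have : K ^ 2 ≤ K ^ 4 := pow_le_pow_right₀ hK (by norm_num)
    have h2 : (2 : ℝ≥0) ≤ 2 ^ (c + 5) := by
      simpa using pow_le_pow_right₀ (one_le_two (α := ℝ≥0)) (show 1 ≤ c + 5 by omega)
    calc 2 * K ^ 2 * ε = 2 * 1 * K ^ 2 * ε := by ring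
      _ ≤ _ := by gcongr
  have hQb := 𝓑.mem_balls_of_mem_picks hB hQ
  have hQl := 𝓑.isLevel_of_mem_picks hB hQ
  set 𝒟 : Set (Set X) := {R | (∃ i, j ≤ i ∧ R ∈ 𝓑.picks B F i) ∧
    (𝓑.hull (𝓑.hull R) ∩ Q).Nonempty} with h𝒟
  have hclosed : ∀ i, j + c < i → ∀ R ∈ 𝒟, R ∈ 𝓑.picks B F i → 𝓑.parent B F R ∈ 𝒟 := by
    rintro i hi R ⟨-, hne⟩ hR
    obtain ⟨n, rfl⟩ : ∃ n, i = n + 1 := ⟨i - 1, by omega⟩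
    have hRb := 𝓑.mem_balls_of_mem_picks hB hR
    have hRl := 𝓑.isLevel_of_mem_picks hB hR
    have hsub : 𝓑.hull (𝓑.hull R) ⊆ 𝓑.hull Q := by
      refine 𝓑.subset_hull Q hQb _ (𝓑.hull_mem _ (𝓑.hull_mem _ hRb)) ?_ hne
      have hc' : (K ^ 2 : ℝ≥0∞) ≤ 2 ^ c := by exact_mod_cast hc
      calc μ (𝓑.hull (𝓑.hull R)) ≤ K ^ 2 * μ R := 𝓑.measure_hull_hull_le hRb
        _ ≤ 2 ^ c * μ R := by gcongr
        _ ≤ μ Q := hQl.pow_mul_measure_le hRl hi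
        _ ≤ 2 * μ Q := le_mul_of_one_le_left' one_le_two
    obtain ⟨-, -, x, hxR, -, hx⟩ := 𝓑.parent_spec hB hR
    have hxQ : x ∈ 𝓑.hull Q :=
      hsub (𝓑.subset_hull_self (𝓑.hull_mem _ hRb) (𝓑.subset_hull_self hRb hxR))
    obtain ⟨l, hl, -, hPl⟩ := 𝓑.le_level_current hQ hxQ (show j ≤ n by omega)
    rw [hx] at hPl
    exact ⟨⟨l, hl, hPl⟩,
      hne.mono (inter_subset_inter_left _ (𝓑.hull_hull_subset_parent hB hF hK2ε hR))⟩
  have hroots : ∑' R : (𝒟 ∩ 𝓑.picksUpTo B F (j + c) : Set (Set X)), μ (R : Set X) ≤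
      (c + 1) * (2 * K ^ 4 * μ Q) := by
    have hcov : 𝒟 ∩ 𝓑.picksUpTo B F (j + c) ⊆
        ⋃ i ∈ Finset.Icc j (j + c), (𝒟 ∩ 𝓑.picks B F i) := by
      rintro R ⟨hR, l, hl, hRl⟩
      obtain ⟨⟨l', hl', hRl'⟩, hne⟩ := id hR
      obtain rfl := (𝓑.isLevel_of_mem_picks hB hRl).unique (𝓑.isLevel_of_mem_picks hB hRl')
      exact mem_iUnion₂.2 ⟨l, Finset.mem_Icc.2 ⟨hl', hl⟩, hR, hRl⟩
    have hK2 : 1 ≤ 2 * K ^ 2 := (one_le_pow₀ hK).trans (le_mul_of_one_le_left' one_le_two)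
    calc ∑' R : (𝒟 ∩ 𝓑.picksUpTo B F (j + c) : Set (Set X)), μ (R : Set X)
        ≤ ∑' R : (⋃ i ∈ Finset.Icc j (j + c), (𝒟 ∩ 𝓑.picks B F i) : Set (Set X)),
            μ (R : Set X) := ENNReal.tsum_mono_subtype (fun R : Set X => μ R) hcov
      _ ≤ ∑ i ∈ Finset.Icc j (j + c), ∑' R : (𝒟 ∩ 𝓑.picks B F i : Set (Set X)), μ (R : Set X) :=
          ENNReal.tsum_biUnion_le (fun R : Set X => μ R) _ _
      _ ≤ ∑ i ∈ Finset.Icc j (j + c), 2 * K ^ 4 * μ Q := by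
          refine Finset.sum_le_sum fun i hi => ?_
          refine (𝓑.tsum_picks_le hB (S := 𝓑.dilate (2 * K ^ 2) Q) inter_subset_right
            ?_).trans ((𝓑.measure_dilate_le hK2 hQb).trans_eq (by push_cast; ring))
          rintro R ⟨⟨-, hne⟩, hR⟩
          have hRb := 𝓑.mem_balls_of_mem_picks hB hR
          refine ((𝓑.subset_hull_self hRb).trans (𝓑.subset_hull_self (𝓑.hull_mem _ hRb))).trans
            (𝓑.subset_dilate hK2 hQb (𝓑.hull_mem _ (𝓑.hull_mem _ hRb)) ?_ hne)
          calc μ (𝓑.hull (𝓑.hull R)) ≤ K ^ 2 * μ R := 𝓑.measure_hull_hull_le hRb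
            _ ≤ K ^ 2 * (2 * μ Q) := by
                gcongr
                exact hQl.measure_le_two_mul (𝓑.isLevel_of_mem_picks hB hR) (Finset.mem_Icc.1 hi).1
            _ = _ := by push_cast; ring
      _ = (c + 1) * (2 * K ^ 4 * μ Q) := by
          rw [Finset.sum_const, Nat.card_Icc, nsmul_eq_mul]
          congr 1
          rw [show j + c + 1 - j = c + 1 by omega]
          push_cast
          rfl
  have hε' : (2 ^ (c + 5) * (c + 1) * K ^ 4 * ε : ℝ≥0∞) ≤ 1 := by exact_mod_cast hε
  -- the family of later balls is exhausted by finitely many levels at a time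
  have hfin (n : ℕ) : 2 * μ (Q ∩ ⋃ i ∈ {i | j < i ∧ i ≤ n}, ⋃₀ 𝓑.picks B F i) ≤ μ Q := by
    have hcount : {R ∈ 𝒟 | ∃ i, j + c < i ∧ i ≤ n ∧ R ∈ 𝓑.picks B F i}.Countable := by
      refine Countable.mono (s₂ := ⋃ i : ℕ, 𝓑.picks B F i) ?_
        (countable_iUnion fun i => 𝓑.countable_picks hB hF hFm hε8 i)
      rintro R ⟨-, i, -, -, hR⟩
      exact mem_iUnion.2 ⟨i, hR⟩
    have := hcount.to_subtype
    calc 2 * μ (Q ∩ ⋃ i ∈ {i | j < i ∧ i ≤ n}, ⋃₀ 𝓑.picks B F i)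
        ≤ 2 * μ (⋃ R : {R ∈ 𝒟 | ∃ i, j + c < i ∧ i ≤ n ∧ R ∈ 𝓑.picks B F i}, (R : Set X)) := by
          gcongr
          rintro y ⟨hyQ, hy⟩
          simp only [mem_iUnion, mem_sUnion] at hy
          obtain ⟨i, ⟨hji, hin⟩, R, hR, hyR⟩ := hy
          have hRb := 𝓑.mem_balls_of_mem_picks hB hR
          refine mem_iUnion.2 ⟨⟨R, ⟨⟨i, hji.le, hR⟩, y, ?_, hyQ⟩, i, ?_, hin, hR⟩, hyR⟩
          · exact 𝓑.subset_hull_self (𝓑.hull_mem _ hRb) (𝓑.subset_hull_self hRb hyR)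
          · exact 𝓑.lt_level_of_inter_nonempty hB hF hε4 hQ hR hji ⟨y, hyR, hyQ⟩
      _ ≤ 2 * (8 * ε * ((c + 1) * (2 * K ^ 4 * μ Q))) := by
          gcongr
          exact (measure_iUnion_le _).trans
            ((𝓑.tsum_level_gt_le hB hF hFm hε8 (j + c) hclosed n).trans (by gcongr))
      _ = 2 ^ 5 * (c + 1) * K ^ 4 * ε * μ Q := by ring
      _ ≤ 2 ^ (c + 5) * (c + 1) * K ^ 4 * ε * μ Q := by
          gcongr
          · norm_num
          · omega
      _ ≤ 1 * μ Q := by gcongr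
      _ = μ Q := one_mul _
  have hmono : Monotone fun n => Q ∩ ⋃ i ∈ {i | j < i ∧ i ≤ n}, ⋃₀ 𝓑.picks B F i :=
    fun n n' hnn' => inter_subset_inter_right _
      (biUnion_subset_biUnion_left fun i hi => ⟨hi.1, hi.2.trans hnn'⟩)
  have hunion : Q ∩ ⋃ i > j, ⋃₀ 𝓑.picks B F i =
      ⋃ n, (Q ∩ ⋃ i ∈ {i | j < i ∧ i ≤ n}, ⋃₀ 𝓑.picks B F i) := by
    rw [← inter_iUnion]
    congr 1
    refine Subset.antisymm (iUnion₂_subset fun i hi => ?_) (iUnion_subset fun n => ?_)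
    · exact subset_iUnion_of_subset i (subset_biUnion_of_mem (u := fun i => ⋃₀ 𝓑.picks B F i)
        (show i ∈ {k | j < k ∧ k ≤ i} from ⟨hi, le_rfl⟩))
    · exact iUnion₂_subset fun i hi =>
        subset_biUnion_of_mem (u := fun i => ⋃₀ 𝓑.picks B F i) (show i ∈ {k | k > j} from hi.1)
  rw [hunion, hmono.measure_iUnion, ENNReal.mul_iSup]
  exact iSup_le hfin

/-- The selected balls are sparse. -/
lemma exists_disjoint_parts {c : ℕ} (hFm : ∀ P ∈ 𝓑.balls, MeasurableSet (F P))
    (hc : K ^ 2 ≤ 2 ^ c) (hε : 2 ^ (c + 5) * (c + 1) * K ^ 4 * ε ≤ 1) :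
    ∃ E : Set X → Set X, {R | ∃ k, R ∈ 𝓑.picks B F k}.PairwiseDisjoint E ∧
      ∀ k, ∀ R ∈ 𝓑.picks B F k, MeasurableSet (E R) ∧ E R ⊆ R ∧ μ R ≤ 2 * μ (E R) := by
  have hK : 1 ≤ K := 𝓑.one_le_const hB
  have hε8 : 8 * ε ≤ 1 := by
    refine le_trans ?_ hε
    calc 8 * ε = 2 ^ 3 * 1 * 1 * ε := by norm_num
      _ ≤ _ := by
        gcongr
        · norm_num
        · omega
        · exact le_add_self
        · exact one_le_pow₀ hK
  refine ⟨fun R => R \ {y | ∃ j, R ∈ 𝓑.picks B F j ∧ y ∈ ⋃ i > j, ⋃₀ 𝓑.picks B F i}, ?_, ?_⟩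
  · rintro R ⟨k, hR⟩ Q ⟨l, hQ⟩ hne
    wlog hkl : k ≤ l generalizing k l R Q
    · exact (this l hQ k hR hne.symm (by omega)).symm
    rcases hkl.eq_or_lt with rfl | hlt
    · exact (𝓑.pairwiseDisjoint_picks k hR hQ hne).mono sdiff_subset sdiff_subset
    · rw [Function.onFun, disjoint_left]
      rintro y ⟨-, hy⟩ ⟨hyQ, -⟩
      exact hy ⟨k, hR, mem_iUnion₂.2 ⟨l, hlt, Q, hQ, hyQ⟩⟩
  · intro k R hR
    have heq : {y | ∃ j, R ∈ 𝓑.picks B F j ∧ y ∈ ⋃ i > j, ⋃₀ 𝓑.picks B F i} =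
        ⋃ i > k, ⋃₀ 𝓑.picks B F i := by
      ext y
      constructor
      · rintro ⟨j, hj, hy⟩
        rwa [← (𝓑.isLevel_of_mem_picks hB hj).unique (𝓑.isLevel_of_mem_picks hB hR)]
      · exact fun hy => ⟨k, hR, hy⟩
    have hm : MeasurableSet (⋃ i > k, ⋃₀ 𝓑.picks B F i) :=
      MeasurableSet.iUnion fun i => MeasurableSet.iUnion fun _ =>
        MeasurableSet.sUnion (𝓑.countable_picks hB hF hFm hε8 i) fun Q hQ =>
          𝓑.measurableSet_picks hB hQ
    have hRm := 𝓑.measurableSet_picks hB hR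
    have hRt := (𝓑.measure_lt_top R (𝓑.mem_balls_of_mem_picks hB hR)).ne
    simp only [heq]
    refine ⟨hRm.diff hm, sdiff_subset, ?_⟩
    have h1 := 𝓑.measure_inter_later_le hB hF hFm hc hε hR
    have h2 := measure_inter_add_sdiff (μ := μ) R hm
    set a := μ (R ∩ ⋃ i > k, ⋃₀ 𝓑.picks B F i)
    set b := μ (R \ ⋃ i > k, ⋃₀ 𝓑.picks B F i)
    have ha : a ≠ ∞ := ne_top_of_le_ne_top hRt (measure_mono inter_subset_left)
    rw [← h2, two_mul] at h1
    rw [← h2, two_mul]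
    gcongr
    exact (ENNReal.add_le_add_iff_left ha).1 h1

end BallBasis

/-! ### Sparse families -/

section Sparse

variable {X : Type*} [MeasurableSpace X] {𝕜 : Type*} [RCLike 𝕜] {μ : Measure X} {K : ℝ≥0}
  (𝓑 : BallBasis μ K) {r : ℝ}

/-- An indexed family of balls `G i` with disjoint large parts. The balls may repeat, but at most
`γ⁻¹` times, so that the family can be replaced with its range. -/
lemma exists_isSparse_range {ι : Type*} {γ : ℝ≥0} (G E : ι → Set X)
    (hG : ∀ i, G i ∈ 𝓑.balls) (hE : ∀ i, MeasurableSet (E i)) (hEG : ∀ i, E i ⊆ G i)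
    (hμ : ∀ i, γ * μ (G i) ≤ μ (E i)) (hd : Pairwise (Function.onFun Disjoint E)) :
    IsSparse 𝓑 γ (range G) ∧ ∀ (f : X → 𝕜) (x : X),
      γ * ∑' i, (G i).indicator (fun _ => avg μ r f (G i)) x ≤ sparseOp μ r (range G) f x := by
  classical
  refine ⟨⟨range_subset_iff.2 hG, fun S => if h : ∃ i, G i = S then E h.choose else ∅, ?_, ?_⟩,
    fun f x => ?_⟩
  · rintro _ ⟨i, rfl⟩
    have h : ∃ j, G j = G i := ⟨i, rfl⟩
    simp only [dif_pos h]
    have h1 := hEG h.choose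
    have h2 := hμ h.choose
    rw [h.choose_spec] at h1 h2
    exact ⟨hE _, h1, h2⟩
  · rintro S hS S' hS' hne
    obtain ⟨i, hi⟩ := id hS
    obtain ⟨i', hi'⟩ := id hS'
    have h : ∃ j, G j = S := ⟨i, hi⟩
    have h' : ∃ j, G j = S' := ⟨i', hi'⟩
    simp only [Function.onFun, dif_pos h, dif_pos h']
    refine hd fun heq => hne ?_
    rw [← h.choose_spec, heq, h'.choose_spec]
  · let p : ι → range G := fun i => ⟨G i, i, rfl⟩
    let a : Set X → ℝ≥0∞ := fun S => S.indicator (fun _ => avg μ r f S) x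
    calc γ * ∑' i, a (G i) = ∑' i, γ * a (p i) := ENNReal.tsum_mul_left.symm
      _ = ∑' S : range G, ∑' i : p ⁻¹' {S}, γ * a (p i) :=
          (ENNReal.tsum_fiberwise (fun i => γ * a (p i)) p).symm
      _ ≤ ∑' S : range G, a S := by
          refine ENNReal.tsum_le_tsum fun S => ?_
          have hS : (S : Set X) ∈ 𝓑.balls := by
            obtain ⟨_, i, rfl⟩ := S
            exact hG i
          have hS0 := (𝓑.measure_pos _ hS).ne'
          have hSt := (𝓑.measure_lt_top _ hS).ne
          have hiS (i : p ⁻¹' {S}) : G i = S := congrArg Subtype.val i.2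
          have hcard : ∑' _ : p ⁻¹' {S}, (γ : ℝ≥0∞) ≤ 1 := by
            refine (ENNReal.mul_le_mul_iff_left hS0 hSt).1 ?_
            rw [← ENNReal.tsum_mul_right, one_mul]
            calc ∑' _ : p ⁻¹' {S}, γ * μ S ≤ ∑' i : p ⁻¹' {S}, μ (E i) := by
                  refine ENNReal.tsum_le_tsum fun i => ?_
                  rw [← hiS i]
                  exact hμ i
              _ ≤ μ (⋃ i : p ⁻¹' {S}, E i) :=
                  tsum_meas_le_meas_iUnion_of_disjoint μ (fun i => hE i)
                    fun i j hij => hd fun h => hij (Subtype.ext h)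
              _ ≤ μ S := measure_mono (iUnion_subset fun i => (hEG i).trans (hiS i).subset)
          calc ∑' i : p ⁻¹' {S}, γ * a (p i) = ∑' _ : p ⁻¹' {S}, γ * a S := by
                congr 1 with i
                rw [show p i = S from i.2]
            _ = (∑' _ : p ⁻¹' {S}, (γ : ℝ≥0∞)) * a S := ENNReal.tsum_mul_right
            _ ≤ 1 * a S := by gcongr
            _ = a S := one_mul _

end Sparse

/-! ### The part of the operator far from a ball -/

namespace IsBOWith

variable {X : Type*} [MeasurableSpace X] {𝕜 : Type*} [RCLike 𝕜] {μ : Measure X} {K : ℝ≥0}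
  {𝓑 : BallBasis μ K} {r : ℝ} {T : (X → 𝕜) → X → 𝕜} {ℓ : ℝ≥0}
  (h : IsBOWith 𝓑 r T ℓ) {A : Set X}
include h

/-- Along a chain of balls of geometrically growing measure around `A`, provided by
`exists_larger_ball`, the truncation of `g` off `A*` telescopes. If the chain is infinite, the
remainder after `n` balls tends to zero by `enorm_compl_hull_le`. The chain does not depend on `g`,
so that the same family serves all truncations of a given function. -/
lemma exists_sparse_compl_hull (hℓ : 0 < ℓ) (hA : A ∈ 𝓑.balls) :
    ∃ (ι : Type) (G E : ι → Set X), (∀ i, G i ∈ 𝓑.balls) ∧ (∀ i, MeasurableSet (E i)) ∧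
      (∀ i, E i ⊆ G i) ∧ (∀ i, μ (G i) ≤ 4 * K ^ 3 * μ (E i)) ∧
      Pairwise (Function.onFun Disjoint E) ∧ (∀ i, A ⊆ G i) ∧
      ∀ x ∈ A, ∀ g : X → 𝕜, MemLp g (ENNReal.ofReal r) μ →
        ‖T ((𝓑.hull A)ᶜ.indicator g) x‖ₑ ≤ 18 * K ^ 8 * ℓ * ∑' i, avg μ r g (G i) := by
  classical
  have hK : 1 ≤ K := 𝓑.one_le_const hA
  have hK' : (1 : ℝ≥0∞) ≤ K := by exact_mod_cast hK
  have hK2 : 1 ≤ 2 * K := hK.trans (le_mul_of_one_le_left' one_le_two)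
  set G : Set X → Set X := 𝓑.dilate (2 * K)
  set terminal : Set X → Prop := fun A => ∀ x ∈ A, ∀ g : X → 𝕜, MemLp g (ENNReal.ofReal r) μ →
      ‖T ((𝓑.hull A)ᶜ.indicator g) x‖ₑ ≤ 6 * K ^ 5 * ℓ * avg μ r g (G A)
  have hnext : ∀ A : Set X, ∃ B : Set X, A ∈ 𝓑.balls → ¬ terminal A → B ∈ 𝓑.balls ∧ A ⊆ B ∧
      2 * K * μ A ≤ μ B ∧ 𝓑.hull A ⊆ 𝓑.hull B ∧ ∀ x ∈ A, ∀ g : X → 𝕜,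
        MemLp g (ENNReal.ofReal r) μ → ‖T ((𝓑.hull B \ 𝓑.hull A).indicator g) x‖ₑ ≤
          6 * K ^ 5 * ℓ * (avg μ r g (G A) + avg μ r g (𝓑.hull B)) := by
    intro A
    by_cases hA : A ∈ 𝓑.balls
    · rcases h.exists_larger_ball hℓ hA with h1 | ⟨B, hB⟩
      · exact ⟨A, fun _ h2 => absurd h1 h2⟩
      · exact ⟨B, fun _ _ => hB⟩
    · exact ⟨A, fun h1 => absurd h1 hA⟩
  choose next hnext using hnext
  let C : ℕ → Set X := fun n => next^[n] A
  have hCs (n : ℕ) : C (n + 1) = next (C n) := Function.iterate_succ_apply' next n A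
  let I : Set ℕ := {n | ∀ k < n, ¬ terminal (C k)}
  have hIdown {n k : ℕ} (hn : n ∈ I) (hkn : k ≤ n) : k ∈ I := fun l hl => hn l (hl.trans_le hkn)
  have hC : ∀ n ∈ I, C n ∈ 𝓑.balls := by
    intro n
    induction n with
    | zero => exact fun _ => hA
    | succ n ih =>
      intro hn
      rw [hCs]
      exact (hnext _ (ih (hIdown hn n.le_succ)) (hn n n.lt_succ_self)).1
  have hstep (n : ℕ) (hn : n + 1 ∈ I) := hnext (C n) (hC n (hIdown hn n.le_succ))
    (hn n n.lt_succ_self)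
  simp only [← hCs] at hstep
  have hCmono {k n : ℕ} (hkn : k ≤ n) : n ∈ I → C k ⊆ C n := by
    induction n, hkn using Nat.le_induction with
    | base => exact fun _ => Subset.rfl
    | succ n hkn ih => exact fun hn => (ih (hIdown hn n.le_succ)).trans (hstep n hn).2.1
  have hAC {n : ℕ} (hn : n ∈ I) : A ⊆ C n := hCmono (zero_le (a := n)) hn
  have hGb {n : ℕ} (hn : n ∈ I) : G (C n) ∈ 𝓑.balls := 𝓑.dilate_mem hK2 (hC n hn)
  have hCG {n : ℕ} (hn : n ∈ I) : C n ⊆ G (C n) := 𝓑.subset_dilate_self hK2 (hC n hn)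
  have hGm {n : ℕ} (hn : n ∈ I) : μ (G (C n)) ≤ 2 * K ^ 3 * μ (C n) := by
    refine (𝓑.measure_dilate_le hK2 (hC n hn)).trans_eq ?_
    push_cast; ring
  -- the hull of a ball of the chain is comparable to its dilate
  have hhull {n : ℕ} (hn : n ∈ I) (g : X → 𝕜) :
      avg μ r g (𝓑.hull (C n)) ≤ 2 * K * avg μ r g (G (C n)) * K ^ 2 := by
    have hCn := hC n hn
    have hsub : 𝓑.hull (C n) ⊆ G (C n) := by
      refine 𝓑.subset_dilate hK2 hCn (𝓑.hull_mem _ hCn) ((𝓑.measure_hull_le _ hCn).trans ?_)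
        ((𝓑.nonempty_of_mem hCn).mono (subset_inter (𝓑.subset_hull_self hCn) Subset.rfl))
      push_cast
      gcongr
      exact le_mul_of_one_le_left' one_le_two
    have hc : (1 : ℝ≥0) ≤ 2 * K ^ 3 := (one_le_pow₀ hK).trans (le_mul_of_one_le_left' one_le_two)
    refine (avg_le_mul_avg h.one_le (𝓑.measurableSet_hull hCn)
      (𝓑.measurableSet_ball _ (hGb hn)) hsub hc ?_).trans_eq (by push_cast; ring)
    refine (hGm hn).trans ?_
    push_cast
    gcongr
    exact 𝓑.subset_hull_self hCn
  -- telescoping up to the `n`-th ball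
  have htel {x : X} (hx : x ∈ A) {g : X → 𝕜} (hg : MemLp g (ENNReal.ofReal r) μ) (n : ℕ)
      (hn : n ∈ I) : ‖T ((𝓑.hull A)ᶜ.indicator g) x‖ₑ ≤
        6 * K ^ 5 * ℓ * ∑ k ∈ Finset.range n, (avg μ r g (G (C k)) + avg μ r g (𝓑.hull (C (k + 1))))
          + ‖T ((𝓑.hull (C n))ᶜ.indicator g) x‖ₑ := by
    induction n with
    | zero => simp [C]
    | succ n ih =>
      have hn' := hIdown hn n.le_succ
      have hs := hstep n hn
      have h1 := h.subadditive.enorm_indicator_le_add hg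
        ((𝓑.measurableSet_hull hs.1).diff (𝓑.measurableSet_hull (hC n hn')))
        (𝓑.measurableSet_hull hs.1).compl (disjoint_compl_right.mono_left sdiff_subset)
        (S := (𝓑.hull (C n))ᶜ) (by
          ext y
          have : y ∈ 𝓑.hull (C n) → y ∈ 𝓑.hull (C (n + 1)) := fun hy => hs.2.2.2.1 hy
          simp only [mem_compl_iff, mem_union, mem_sdiff]
          tauto) x
      have h2 := hs.2.2.2.2 x (hAC hn' hx) g hg
      rw [Finset.sum_range_succ, mul_add, add_assoc]
      exact (ih hn').trans (add_le_add le_rfl (h1.trans (add_le_add h2 le_rfl)))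
  refine ⟨I, fun n => G (C n), fun n => if (n : ℕ) = 0 then C n else C n \ C (n - 1),
    fun n => hGb n.2, fun n => ?_, fun n => ?_, fun n => ?_, ?_, fun n => (hAC n.2).trans (hCG n.2),
    fun x hx g hg => ?_⟩
  · dsimp only
    have hm := 𝓑.measurableSet_ball _ (hC n n.2)
    split_ifs
    · exact hm
    · exact hm.diff (𝓑.measurableSet_ball _ (hC _ (hIdown n.2 (Nat.sub_le _ _))))
  · dsimp only
    split_ifs
    · exact hCG n.2
    · exact sdiff_subset.trans (hCG n.2)
  · dsimp only
    have hhalf : μ (C n) ≤ 2 * μ (if (n : ℕ) = 0 then C n else C n \ C (n - 1)) := by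
      obtain ⟨n, hn⟩ := n
      dsimp only
      rcases n with _ | n
      · simpa using le_mul_of_one_le_left' (one_le_two (α := ℝ≥0∞))
      · simp only [Nat.add_eq_zero_iff, one_ne_zero, and_false, if_false, Nat.add_sub_cancel]
        have hn' := hIdown hn n.le_succ
        have hs := hstep n hn
        have hsub := hs.2.1
        have e1 := measure_sdiff hsub (𝓑.measurableSet_ball _ (hC n hn')).nullMeasurableSet
          (𝓑.measure_lt_top _ (hC n hn')).ne
        rw [e1, ENNReal.mul_sub (fun _ _ => by simp), two_mul (μ (C (n + 1)))]
        refine ENNReal.le_sub_of_add_le_right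
          (ENNReal.mul_ne_top (by simp) (𝓑.measure_lt_top _ (hC n hn')).ne) ?_
        gcongr
        refine le_trans ?_ hs.2.2.1
        gcongr
        exact le_mul_of_one_le_right' hK'
    calc μ (G (C n)) ≤ 2 * K ^ 3 * μ (C n) := hGm n.2
      _ ≤ 2 * K ^ 3 * (2 * μ (if (n : ℕ) = 0 then C n else C n \ C (n - 1))) := by gcongr
      _ = _ := by ring
  · intro k n hkn
    wlog hlt : (k : ℕ) < n generalizing k n
    · have hne : (k : ℕ) ≠ n := fun h => hkn (Subtype.ext h)
      exact (this hkn.symm (by omega)).symm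
    have hn0 : (n : ℕ) ≠ 0 := by omega
    simp only [Function.onFun, if_neg hn0]
    refine Disjoint.mono_left (b := C (n - 1)) ?_ disjoint_sdiff_right
    have : C k ⊆ C (n - 1) := hCmono (by omega) (hIdown n.2 (Nat.sub_le _ _))
    split_ifs
    · exact this
    · exact sdiff_subset.trans this
  · set σ := ∑' n : I, avg μ r g (G (C n)) with hσ
    -- each partial sum is controlled by the sum over the whole chain
    have hpartial (n : ℕ) (hn : n ∈ I) :
        ∑ k ∈ Finset.range (n + 1), avg μ r g (G (C k)) ≤ σ := by
      have hsub : ∀ k ∈ Finset.range (n + 1), k ∈ I := fun k hk =>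
        hIdown hn (Nat.lt_succ_iff.1 (Finset.mem_range.1 hk))
      rw [← Finset.sum_subtype_of_mem (fun k => avg μ r g (G (C k))) hsub]
      exact ENNReal.sum_le_tsum _
    have hbound (n : ℕ) (hn : n ∈ I) : ‖T ((𝓑.hull A)ᶜ.indicator g) x‖ₑ ≤
        6 * K ^ 5 * ℓ * (∑ k ∈ Finset.range n, avg μ r g (G (C k)) + 2 * K * σ * K ^ 2) +
          ‖T ((𝓑.hull (C n))ᶜ.indicator g) x‖ₑ := by
      refine (htel hx hg n hn).trans ?_
      rw [Finset.sum_add_distrib]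
      gcongr
      calc ∑ k ∈ Finset.range n, avg μ r g (𝓑.hull (C (k + 1)))
          ≤ ∑ k ∈ Finset.range n, 2 * K * avg μ r g (G (C (k + 1))) * K ^ 2 :=
            Finset.sum_le_sum fun k hk =>
              hhull (hIdown hn (Nat.succ_le_of_lt (Finset.mem_range.1 hk))) g
        _ = 2 * K * (∑ k ∈ Finset.range n, avg μ r g (G (C (k + 1)))) * K ^ 2 := by
            rw [← Finset.sum_mul, ← Finset.mul_sum]
        _ ≤ 2 * K * σ * K ^ 2 := by
            gcongr
            refine le_trans ?_ (hpartial n hn)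
            rw [Finset.sum_range_succ']
            exact le_self_add
    have hcoef : 6 * K ^ 5 * ℓ * (σ + 2 * K * σ * K ^ 2) ≤ 18 * K ^ 8 * ℓ * σ := by
      calc 6 * K ^ 5 * ℓ * (σ + 2 * K * σ * K ^ 2)
          = 6 * K ^ 5 * ℓ * (1 * σ + 2 * K ^ 3 * σ) := by ring
        _ ≤ 6 * K ^ 5 * ℓ * (K ^ 3 * σ + 2 * K ^ 3 * σ) := by
            gcongr
            exact one_le_pow₀ hK'
        _ = 18 * K ^ 8 * ℓ * σ := by ring
    by_cases hex : ∃ n ∈ I, terminal (C n)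
    · obtain ⟨n, hn, hs⟩ := hex
      refine (hbound n hn).trans (le_trans ?_ hcoef)
      calc _ ≤ 6 * K ^ 5 * ℓ * (∑ k ∈ Finset.range n, avg μ r g (G (C k)) + 2 * K * σ * K ^ 2) +
            6 * K ^ 5 * ℓ * avg μ r g (G (C n)) := by
              gcongr
              exact hs x (hAC hn hx) g hg
        _ = 6 * K ^ 5 * ℓ *
            (∑ k ∈ Finset.range (n + 1), avg μ r g (G (C k)) + 2 * K * σ * K ^ 2) := by
              rw [Finset.sum_range_succ]; ring
        _ ≤ _ := by
              gcongr
              exact hpartial n hn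
    · push Not at hex
      have hI : ∀ n, n ∈ I := by
        intro n
        induction n with
        | zero => exact fun k hk => absurd hk (Nat.not_lt_zero k)
        | succ n ih =>
          intro k hk
          rcases (Nat.lt_succ_iff.1 hk).eq_or_lt with rfl | hlt
          · exact hex _ ih
          · exact ih k hlt
      have hgrow (n : ℕ) : 2 ^ n * μ A ≤ μ (C n) := by
        induction n with
        | zero => simp [C]
        | succ n ih =>
          calc 2 ^ (n + 1) * μ A = 2 * 1 * (2 ^ n * μ A) := by ring
            _ ≤ 2 * K * μ (C n) := by gcongr
            _ ≤ μ (C (n + 1)) := (hstep n (hI _)).2.2.1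
      have hle (n : ℕ) : ‖T ((𝓑.hull A)ᶜ.indicator g) x‖ₑ ≤
          18 * K ^ 8 * ℓ * σ + 3 * ℓ * mean μ r g (2 ^ n * μ A) := by
        refine (hbound n (hI n)).trans (add_le_add (le_trans ?_ hcoef) ?_)
        · gcongr
          refine le_trans ?_ (hpartial n (hI n))
          rw [Finset.sum_range_succ]
          exact le_self_add
        · refine (h.enorm_compl_hull_le hg hℓ (hC n (hI n)) (hAC (hI n) hx)).trans ?_
          gcongr
          exact mean_anti h.one_le (hgrow n)
      have hr0 : 0 < r := zero_lt_one.trans_le h.one_le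
      have hlim : Filter.Tendsto (fun n : ℕ => mean μ r g (2 ^ n * μ A)) Filter.atTop (nhds 0) := by
        have h1 : Filter.Tendsto (fun n : ℕ => (2 : ℝ≥0∞) ^ n * μ A) Filter.atTop (nhds ∞) := by
          have := ENNReal.Tendsto.mul_const (b := μ A)
            (ENNReal.tendsto_pow_atTop_nhds_top_iff.2 ENNReal.one_lt_two)
            (Or.inl ENNReal.top_ne_zero)
          rwa [ENNReal.top_mul (𝓑.measure_pos A hA).ne'] at this
        have h2 := ENNReal.Tendsto.const_div (a := ∫⁻ x, ‖g x‖ₑ ^ r ∂μ) h1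
          (Or.inr (lintegral_enorm_rpow_lt_top h.one_le hg).ne)
        rw [ENNReal.div_top] at h2
        have h3 := (ENNReal.continuous_rpow_const (y := 1 / r)).tendsto 0
        rw [ENNReal.zero_rpow_of_pos (by positivity)] at h3
        exact h3.comp h2
      have hlim2 := (ENNReal.Tendsto.const_mul hlim
        (Or.inr (show (3 * ℓ : ℝ≥0∞) ≠ ∞ by finiteness))).const_add (18 * K ^ 8 * ℓ * σ)
      rw [mul_zero, add_zero] at hlim2
      exact ge_of_tendsto' hlim2 hle

end IsBOWith

/-! ### The local part of the operator -/

namespace BallBasis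

variable {X : Type*} [MeasurableSpace X] {μ : Measure X} {K : ℝ≥0} (𝓑 : BallBasis μ K)
  {A P : Set X} {x : X}

/-- A ball around the hull of `P`, large enough for `BallBasis.hull_subset_localSupport`. -/
noncomputable def localBall (P : Set X) : Set X := 𝓑.dilate (2 * K) (𝓑.hull P)

/-- The set to which `f` is restricted while `P` is the current ball. It is a hull, so that the
hypotheses on `T` apply to truncations outside it. -/
noncomputable def localSupport (P : Set X) : Set X := 𝓑.hull (𝓑.localBall P)

/-- The ball over which `f` is averaged in the sparse operator on account of the selected ball
`P`. -/
noncomputable def sparseBall (P : Set X) : Set X := 𝓑.dilate (2 * K) (𝓑.localBall P)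

section

variable (hP : P ∈ 𝓑.balls)
include hP

lemma one_le_two_mul_const : 1 ≤ 2 * K :=
  (𝓑.one_le_const hP).trans (le_mul_of_one_le_left' one_le_two)

lemma localBall_mem : 𝓑.localBall P ∈ 𝓑.balls :=
  𝓑.dilate_mem (𝓑.one_le_two_mul_const hP) (𝓑.hull_mem _ hP)

lemma localSupport_mem : 𝓑.localSupport P ∈ 𝓑.balls := 𝓑.hull_mem _ (𝓑.localBall_mem hP)

lemma sparseBall_mem : 𝓑.sparseBall P ∈ 𝓑.balls :=
  𝓑.dilate_mem (𝓑.one_le_two_mul_const hP) (𝓑.localBall_mem hP)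

lemma hull_subset_localBall : 𝓑.hull P ⊆ 𝓑.localBall P :=
  𝓑.subset_dilate_self (𝓑.one_le_two_mul_const hP) (𝓑.hull_mem _ hP)

lemma subset_localBall : P ⊆ 𝓑.localBall P :=
  (𝓑.subset_hull_self hP).trans (𝓑.hull_subset_localBall hP)

lemma localBall_subset_localSupport : 𝓑.localBall P ⊆ 𝓑.localSupport P :=
  𝓑.subset_hull_self (𝓑.localBall_mem hP)

lemma localSupport_subset_sparseBall : 𝓑.localSupport P ⊆ 𝓑.sparseBall P := by
  refine 𝓑.subset_dilate (𝓑.one_le_two_mul_const hP) (𝓑.localBall_mem hP) (𝓑.localSupport_mem hP)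
    ((𝓑.measure_hull_le _ (𝓑.localBall_mem hP)).trans ?_)
    ((𝓑.nonempty_of_mem (𝓑.localBall_mem hP)).mono
      (subset_inter (𝓑.localBall_subset_localSupport hP) Subset.rfl))
  push_cast
  gcongr
  exact le_mul_of_one_le_left' one_le_two

lemma measure_localBall_le : μ (𝓑.localBall P) ≤ 2 * K ^ 4 * μ P := by
  calc μ (𝓑.localBall P) ≤ K ^ 2 * (2 * K : ℝ≥0) * μ (𝓑.hull P) :=
        𝓑.measure_dilate_le (𝓑.one_le_two_mul_const hP) (𝓑.hull_mem _ hP)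
    _ ≤ K ^ 2 * (2 * K : ℝ≥0) * (K * μ P) := by gcongr; exact 𝓑.measure_hull_le _ hP
    _ = 2 * K ^ 4 * μ P := by push_cast; ring

lemma measure_localSupport_le : μ (𝓑.localSupport P) ≤ 2 * K ^ 5 * μ P := by
  calc μ (𝓑.localSupport P) ≤ K * μ (𝓑.localBall P) := 𝓑.measure_hull_le _ (𝓑.localBall_mem hP)
    _ ≤ K * (2 * K ^ 4 * μ P) := by gcongr; exact 𝓑.measure_localBall_le hP
    _ = 2 * K ^ 5 * μ P := by ring

lemma measure_sparseBall_le : μ (𝓑.sparseBall P) ≤ 4 * K ^ 7 * μ P := by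
  calc μ (𝓑.sparseBall P) ≤ K ^ 2 * (2 * K : ℝ≥0) * μ (𝓑.localBall P) :=
        𝓑.measure_dilate_le (𝓑.one_le_two_mul_const hP) (𝓑.localBall_mem hP)
    _ ≤ K ^ 2 * (2 * K : ℝ≥0) * (2 * K ^ 4 * μ P) := by gcongr; exact 𝓑.measure_localBall_le hP
    _ = 4 * K ^ 7 * μ P := by push_cast; ring

lemma hull_subset_localSupport (hA : A ∈ 𝓑.balls) (hxA : x ∈ A) (hx : x ∈ 𝓑.hull P)
    (hAP : μ A ≤ 2 * μ P) : 𝓑.hull A ⊆ 𝓑.localSupport P := by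
  refine (𝓑.subset_dilate (𝓑.one_le_two_mul_const hP) (𝓑.hull_mem _ hP) (𝓑.hull_mem _ hA) ?_
    ⟨x, 𝓑.subset_hull_self hA hxA, hx⟩).trans (𝓑.localBall_subset_localSupport hP)
  calc μ (𝓑.hull A) ≤ K * (2 * μ P) := (𝓑.measure_hull_le A hA).trans (by gcongr)
    _ = 2 * K * μ P := by ring
    _ ≤ (2 * K : ℝ≥0) * μ (𝓑.hull P) := by
        push_cast
        gcongr
        exact 𝓑.subset_hull_self hP

lemma avg_localSupport_le {𝕜 : Type*} [RCLike 𝕜] {r : ℝ} (hr : 1 ≤ r) (f : X → 𝕜) :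
    avg μ r f (𝓑.localSupport P) ≤ 4 * K ^ 7 * avg μ r f (𝓑.sparseBall P) := by
  have hc : (1 : ℝ≥0) ≤ 4 * K ^ 7 :=
    (one_le_pow₀ (𝓑.one_le_const hP)).trans (le_mul_of_one_le_left' (by norm_num))
  have hm : μ (𝓑.sparseBall P) ≤ (4 * K ^ 7 : ℝ≥0) * μ (𝓑.localSupport P) := by
    refine (𝓑.measure_sparseBall_le hP).trans ?_
    push_cast
    gcongr
    exact (𝓑.subset_localBall hP).trans (𝓑.localBall_subset_localSupport hP)
  refine (avg_le_mul_avg hr (𝓑.measurableSet_ball _ (𝓑.localSupport_mem hP))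
    (𝓑.measurableSet_ball _ (𝓑.sparseBall_mem hP)) (𝓑.localSupport_subset_sparseBall hP) hc
    hm).trans_eq (by push_cast; ring)

end

section exceptional

variable {𝕜 : Type*} [RCLike 𝕜] (r : ℝ) (T : (X → 𝕜) → X → 𝕜) (ℓ Λ : ℝ≥0) (f : X → 𝕜)

/-- A measurable set outside which the maximal truncation and the maximal function of the
restriction of `f` to the local support of `P` are bounded by multiples of the average of `f`. -/
noncomputable def exceptionalSet (P : Set X) : Set X :=
  toMeasurable μ
    ({x | 6 * K * Λ * ℓ * avg μ r f (𝓑.localSupport P) <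
        maxTrunc 𝓑 T ((𝓑.localSupport P).indicator f) x} ∪
      𝓑.maximalSet r ((𝓑.localSupport P).indicator f) (Λ * avg μ r f (𝓑.localSupport P)))

lemma measurableSet_exceptionalSet : MeasurableSet (𝓑.exceptionalSet r T ℓ Λ f P) :=
  measurableSet_toMeasurable _ _

end exceptional

end BallBasis

namespace IsBOWith

variable {X : Type*} [MeasurableSpace X] {𝕜 : Type*} [RCLike 𝕜] {μ : Measure X} {K : ℝ≥0}
  {𝓑 : BallBasis μ K} {r : ℝ} {T : (X → 𝕜) → X → 𝕜} {ℓ Λ : ℝ≥0}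
  (h : IsBOWith 𝓑 r T ℓ) {f : X → 𝕜} {A B D P R : Set X} {x : X}
include h

lemma mul_measure_exceptionalSet_le (hf : MemLp f (ENNReal.ofReal r) μ) (hℓ : 0 < ℓ) (hΛ : 1 ≤ Λ)
    (hP : P ∈ 𝓑.balls) : Λ * μ (𝓑.exceptionalSet r T ℓ Λ f P) ≤ 8 * K ^ 6 * μ P := by
  set U := 𝓑.localSupport P with hU
  have hUb : U ∈ 𝓑.balls := 𝓑.localSupport_mem hP
  have hUm := 𝓑.measurableSet_ball U hUb
  have hg := hf.indicator hUm
  have h0 := (𝓑.measure_pos U hUb).ne'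
  have ht := (𝓑.measure_lt_top U hUb).ne
  have h1 := h.mul_measure_maxTrunc_gt_le 𝓑 hg h0 ht hℓ hΛ (𝓑.one_le_const hP)
  have h2 := 𝓑.mul_measure_maximalSet_le h.one_le hg h0 ht hΛ
  rw [mean_indicator h.one_le hUm] at h1 h2
  rw [BallBasis.exceptionalSet, measure_toMeasurable]
  calc _ ≤ Λ * μ {x | 6 * K * Λ * ℓ * avg μ r f U < maxTrunc 𝓑 T (U.indicator f) x} +
        Λ * μ (𝓑.maximalSet r (U.indicator f) (Λ * avg μ r f U)) := by
          rw [← mul_add]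
          gcongr
          exact measure_union_le _ _
    _ ≤ 3 * K * μ U + K * μ U := add_le_add h1 h2
    _ = 4 * K * μ U := by ring
    _ ≤ 4 * K * (2 * K ^ 5 * μ P) := by gcongr; exact 𝓑.measure_localSupport_le hP
    _ = 8 * K ^ 6 * μ P := by ring

/-- If the ball `D` is not mostly exceptional for `P`, the maximal functions are controlled at some
point of `D`, and the localization property carries the bounds over to all of `D`. -/
lemma bounds_of_measure_inter_lt (hf : MemLp f (ENNReal.ofReal r) μ) (hP : P ∈ 𝓑.balls)
    (hD : D ∈ 𝓑.balls) (hlt : 4 * μ (D ∩ 𝓑.exceptionalSet r T ℓ Λ f P) < μ D) :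
    (∀ x ∈ D, ‖T ((𝓑.localSupport P \ 𝓑.hull D).indicator f) x‖ₑ ≤
      7 * K * Λ * ℓ * avg μ r f (𝓑.localSupport P)) ∧
    ∀ D' ∈ 𝓑.balls, D ⊆ D' → avg μ r ((𝓑.localSupport P).indicator f) D' ≤
      Λ * avg μ r f (𝓑.localSupport P) := by
  have hK : (1 : ℝ≥0∞) ≤ K := by exact_mod_cast 𝓑.one_le_const hP
  set U := 𝓑.localSupport P with hU
  have hUm := 𝓑.measurableSet_ball U (𝓑.localSupport_mem hP)
  have hg := hf.indicator hUm
  obtain ⟨y, hyD, hy⟩ := exists_mem_notMem_of_measure_lt (lt_of_le_of_lt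
    (le_mul_of_one_le_left' (show (1 : ℝ≥0∞) ≤ 4 by norm_num)) hlt)
  have hy' : y ∉ 𝓑.exceptionalSet r T ℓ Λ f P := fun hy' => hy ⟨hyD, hy'⟩
  have hy2 := not_or.1 (show ¬ (_ ∨ _) from fun hmem => hy' (subset_toMeasurable _ _ hmem))
  have hmax : ∀ D' ∈ 𝓑.balls, D ⊆ D' → avg μ r (U.indicator f) D' ≤ Λ * avg μ r f U :=
    fun D' hD' hDD' => 𝓑.avg_le_of_notMem_maximalSet hy2.2 hD' (hDD' hyD)
  refine ⟨fun x hx => ?_, hmax⟩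
  have e1 : ‖T ((𝓑.hull D)ᶜ.indicator (U.indicator f)) y‖ₑ ≤ 6 * K * Λ * ℓ * avg μ r f U := by
    refine le_trans ?_ (not_lt.1 hy2.1)
    exact le_iSup₂_of_le
      (f := fun B _ => ⨆ _ : y ∈ B, ‖T ((𝓑.hull B)ᶜ.indicator (U.indicator f)) y‖ₑ) D hD
      (le_iSup_of_le hyD le_rfl)
  have e2 : ‖T ((𝓑.hull D)ᶜ.indicator (U.indicator f)) x -
      T ((𝓑.hull D)ᶜ.indicator (U.indicator f)) y‖ₑ ≤ ℓ * (Λ * avg μ r f U) := by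
    refine (h.enorm_sub_le D hD x hx y hyD _ hg).trans ?_
    gcongr
    exact iSup₂_le fun D' hD' => iSup_le fun hDD' => hmax D' hD' hDD'
  have heq : (U \ 𝓑.hull D).indicator f = (𝓑.hull D)ᶜ.indicator (U.indicator f) := by
    rw [indicator_indicator, inter_comm, ← sdiff_eq]
  rw [heq]
  set g := (𝓑.hull D)ᶜ.indicator (U.indicator f)
  calc ‖T g x‖ₑ ≤ ‖T g x - T g y‖ₑ + ‖T g y‖ₑ := by
        simpa using enorm_add_le (T g x - T g y) (T g y)
    _ ≤ ℓ * (Λ * avg μ r f U) + 6 * K * Λ * ℓ * avg μ r f U := add_le_add e2 e1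
    _ = 1 * (Λ * ℓ * avg μ r f U) + 6 * K * Λ * ℓ * avg μ r f U := by ring
    _ ≤ K * (Λ * ℓ * avg μ r f U) + 6 * K * Λ * ℓ * avg μ r f U := by gcongr
    _ = 7 * K * Λ * ℓ * avg μ r f U := by ring

/-- Passing from the local support of `P` to that of `R`, at a point in the hull of `R` around which
no ball much larger than `R` is mostly exceptional for `P`. -/
lemma enorm_localSupport_sdiff_le (hf : MemLp f (ENNReal.ofReal r) μ) (hℓ : 0 < ℓ) (hΛ : 1 ≤ Λ)
    (hP : P ∈ 𝓑.balls) (hR : R ∈ 𝓑.balls) (hRP : μ R ≤ 2 * μ P) (hxP : x ∈ 𝓑.hull P)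
    (hxR : x ∈ 𝓑.hull R)
    (hlow : ∀ D ∈ 𝓑.balls, x ∈ D → 2 * μ R ≤ μ D →
      4 * μ (D ∩ 𝓑.exceptionalSet r T ℓ Λ f P) < μ D) :
    ‖T ((𝓑.localSupport P \ 𝓑.localSupport R).indicator f) x‖ₑ +
      ‖T ((𝓑.localSupport R \ 𝓑.localSupport P).indicator f) x‖ₑ ≤
      100 * K ^ 12 * Λ * ℓ * (avg μ r f (𝓑.sparseBall P) + avg μ r f (𝓑.sparseBall R)) := by
  have hK := 𝓑.one_le_const hP
  have hK' : (1 : ℝ≥0∞) ≤ K := by exact_mod_cast hK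
  have hΛ' : (1 : ℝ≥0∞) ≤ Λ := by exact_mod_cast hΛ
  have hUPm := 𝓑.measurableSet_ball _ (𝓑.localSupport_mem hP)
  have hURm := 𝓑.measurableSet_ball _ (𝓑.localSupport_mem hR)
  have hg := hf.indicator hUPm
  have haP := 𝓑.avg_localSupport_le hP h.one_le f
  have haR := 𝓑.avg_localSupport_le hR h.one_le f
  set a := avg μ r f (𝓑.sparseBall P)
  set b := avg μ r f (𝓑.sparseBall R)
  have hxZR := 𝓑.hull_subset_localBall hR hxR
  have hind (S : Set X) : (𝓑.localSupport P ∩ S).indicator f =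
      S.indicator ((𝓑.localSupport P).indicator f) := by
    rw [indicator_indicator, inter_comm]
  have hb : avg μ r ((𝓑.localSupport P).indicator f) (𝓑.dilate (2 * K) (𝓑.localBall R)) ≤ b :=
    avg_indicator_le h.one_le
  have e1 : ‖T ((𝓑.localSupport P \ 𝓑.localSupport R).indicator f) x‖ₑ ≤
      52 * K ^ 12 * Λ * ℓ * (a + b) := by
    have hcoef : (6 * K ^ 5 : ℝ≥0∞) ≤ 52 * K ^ 12 * Λ := by
      calc (6 * K ^ 5 : ℝ≥0∞) = 6 * K ^ 5 * 1 := by ring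
        _ ≤ 52 * K ^ 12 * Λ := by gcongr <;> norm_num
    rcases h.exists_larger_ball hℓ (𝓑.localBall_mem hR) with h1 | ⟨D, hD, hRD, hμD, hhD, h1⟩
    · rw [sdiff_eq, hind]
      refine (h1 x hxZR _ hg).trans ?_
      gcongr
      exact hb.trans le_add_self
    · have hxD := hRD hxZR
      have hRD' : 2 * μ R ≤ μ D := by
        refine le_trans ?_ hμD
        gcongr
        · exact le_mul_of_one_le_right' hK'
        · exact 𝓑.subset_localBall hR
      obtain ⟨b1, b2⟩ := h.bounds_of_measure_inter_lt hf hP hD (hlow D hD hxD hRD')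
      have hhDm := 𝓑.measurableSet_hull hD
      have e := h.subadditive.enorm_indicator_le_add hf
        (hUPm.inter (hhDm.diff hURm)) (hUPm.diff hhDm)
        (disjoint_sdiff_right.mono_left (inter_subset_right.trans sdiff_subset))
        (S := 𝓑.localSupport P \ 𝓑.localSupport R) (by
          ext y
          have : y ∈ 𝓑.localSupport R → y ∈ 𝓑.hull D := fun hy => hhD hy
          simp only [mem_union, mem_inter_iff, mem_sdiff]
          tauto) x
      have e' := h1 x hxZR _ hg
      rw [← BallBasis.localSupport, ← hind] at e'
      refine e.trans ((add_le_add e' (b1 x hxD)).trans ?_)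
      calc _ ≤ 6 * K ^ 5 * ℓ * (b + Λ * (4 * K ^ 7 * a)) + 7 * K * Λ * ℓ * (4 * K ^ 7 * a) := by
            gcongr
            exact (b2 _ (𝓑.hull_mem D hD) (𝓑.subset_hull_self hD)).trans (by gcongr)
        _ = 6 * K ^ 5 * ℓ * b + 24 * K ^ 12 * Λ * ℓ * a + 28 * K ^ 8 * Λ * ℓ * a := by ring
        _ ≤ 52 * K ^ 12 * Λ * ℓ * b + 24 * K ^ 12 * Λ * ℓ * a + 28 * K ^ 12 * Λ * ℓ * a := by
            gcongr
            norm_num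
        _ = 52 * K ^ 12 * Λ * ℓ * (a + b) := by ring
  have e2 : ‖T ((𝓑.localSupport R \ 𝓑.localSupport P).indicator f) x‖ₑ ≤
      48 * K ^ 12 * Λ * ℓ * (a + b) := by
    have hm : μ (𝓑.localSupport R) ≤ (4 * K ^ 5 : ℝ≥0) * μ (𝓑.localBall P) := by
      calc μ (𝓑.localSupport R) ≤ 2 * K ^ 5 * μ R := 𝓑.measure_localSupport_le hR
        _ ≤ 2 * K ^ 5 * (2 * μ P) := by gcongr
        _ = 4 * K ^ 5 * μ P := by ring
        _ ≤ _ := by push_cast; gcongr; exact 𝓑.subset_localBall hP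
    have hc : (1 : ℝ≥0) ≤ 4 * K ^ 5 :=
      (one_le_pow₀ hK).trans (le_mul_of_one_le_left' (by norm_num))
    refine (h.enorm_diff_hull_le hf hℓ (𝓑.localBall_mem hP) hURm hc hm
      (𝓑.hull_subset_localBall hP hxP)).trans ?_
    push_cast
    calc 3 * (4 * K ^ 5) * ℓ * avg μ r f (𝓑.localSupport R)
        ≤ 3 * (4 * K ^ 5) * ℓ * (4 * K ^ 7 * b) := by gcongr
      _ = 48 * K ^ 12 * 1 * ℓ * b := by ring
      _ ≤ 48 * K ^ 12 * Λ * ℓ * (a + b) := by gcongr; exact le_add_self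
  calc _ ≤ 52 * K ^ 12 * Λ * ℓ * (a + b) + 48 * K ^ 12 * Λ * ℓ * (a + b) := add_le_add e1 e2
    _ = 100 * K ^ 12 * Λ * ℓ * (a + b) := by ring

/-- Telescoping along the balls assigned to `x`: the finite set `s` consists of those that
have been replaced up to stage `k`. -/
lemma exists_finset_enorm_le {ε : ℝ≥0} (hf : MemLp f (ENNReal.ofReal r) μ) (hℓ : 0 < ℓ)
    (hΛ : 1 ≤ Λ) (hB : B ∈ 𝓑.balls) (hε : 16 * ε ≤ 1)
    (hF : ∀ P ∈ 𝓑.balls, μ (𝓑.exceptionalSet r T ℓ Λ f P) ≤ ε * μ P)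
    (hx : x ∈ 𝓑.hull B) (k : ℕ) :
    ∃ s : Finset (Set X), 𝓑.current B (𝓑.exceptionalSet r T ℓ Λ f) k x ∉ s ∧
      (∀ R ∈ s, R ∈ 𝓑.picksUpTo B (𝓑.exceptionalSet r T ℓ Λ f) k ∧ x ∈ 𝓑.hull R) ∧
      ∀ A ∈ 𝓑.balls, x ∈ A →
        (0 < k → μ A ≤ 2 * μ (𝓑.current B (𝓑.exceptionalSet r T ℓ Λ f) k x)) →
        ‖T ((𝓑.localSupport B \ 𝓑.hull A).indicator f) x‖ₑ ≤
          100 * K ^ 12 * Λ * ℓ * (2 * ∑ R ∈ s, avg μ r f (𝓑.sparseBall R) +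
            avg μ r f (𝓑.sparseBall (𝓑.current B (𝓑.exceptionalSet r T ℓ Λ f) k x))) +
          ‖T ((𝓑.localSupport (𝓑.current B (𝓑.exceptionalSet r T ℓ Λ f) k x) \
            𝓑.hull A).indicator f) x‖ₑ := by
  classical
  set F := 𝓑.exceptionalSet r T ℓ Λ f
  induction k with
  | zero =>
    refine ⟨∅, by simp, by simp, fun A hA hxA _ => ?_⟩
    rw [𝓑.current_zero]
    exact le_add_self
  | succ k ih =>
    obtain ⟨s, hs, hs', ih⟩ := ih
    by_cases hex : ∃ R ∈ 𝓑.picks B F (k + 1), x ∈ 𝓑.hull R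
    · obtain ⟨hRk, hxR⟩ := 𝓑.current_succ_of_exists B F hex
      obtain ⟨hPk, hxP⟩ := 𝓑.current_mem (F := F) hx k
      have hlow := fun (D : Set X) (hD : D ∈ 𝓑.balls) (hxD : x ∈ D) =>
        𝓑.four_mul_measure_inter_lt hB hF hε hx hD hxD (k := k)
      set P := 𝓑.current B F k x
      set R := 𝓑.current B F (k + 1) x
      have hRb := 𝓑.mem_balls_of_mem_picks hB hRk
      have hPb := 𝓑.mem_balls_of_mem_picksUpTo hB hPk
      have hRl := 𝓑.isLevel_of_mem_picks hB hRk
      obtain ⟨i, hik, hPi⟩ := id hPk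
      have hPl := 𝓑.isLevel_of_mem_picks hB hPi
      have hRP : μ R ≤ μ P := by
        simpa using hPl.pow_mul_measure_le (n := 0) hRl (by omega)
      have hRnot : R ∉ 𝓑.picksUpTo B F k := by
        rintro ⟨l, hl, hRl'⟩
        have := (𝓑.isLevel_of_mem_picks hB hRl').unique hRl
        omega
      refine ⟨insert P s, ?_, ?_, fun A hA hxA hAR => ?_⟩
      · rw [Finset.mem_insert, not_or]
        exact ⟨fun h => hRnot (h ▸ hPk), fun h => hRnot (hs' _ h).1⟩
      · intro Q hQ
        have hQ' : Q ∈ 𝓑.picksUpTo B F k ∧ x ∈ 𝓑.hull Q := by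
          rcases Finset.mem_insert.1 hQ with rfl | hQ
          exacts [⟨hPk, hxP⟩, hs' Q hQ]
        obtain ⟨⟨l, hl, hQl⟩, hxQ⟩ := hQ'
        exact ⟨⟨l, hl.trans k.le_succ, hQl⟩, hxQ⟩
      · have hAR' := hAR k.succ_pos
        have hAP : μ A ≤ 2 * μ P := hAR'.trans (by gcongr)
        have h1 := ih A hA hxA fun _ => hAP
        have hAUP := 𝓑.hull_subset_localSupport hPb hA hxA hxP hAP
        have hAUR := 𝓑.hull_subset_localSupport hRb hA hxA hxR hAR'
        have h2 := h.enorm_localSupport_sdiff_le hf hℓ hΛ hPb hRb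
          (hRP.trans (le_mul_of_one_le_left' one_le_two)) hxP hxR (fun D hD hxD hRD => by
            refine hlow D hD hxD (hRl.1.trans_le ?_)
            calc 2 ^ (k + 1 + 1) * μ R = 2 ^ (k + 1) * (2 * μ R) := by ring
              _ ≤ _ := by gcongr)
        have hUP := 𝓑.measurableSet_ball _ (𝓑.localSupport_mem hPb)
        have hUR := 𝓑.measurableSet_ball _ (𝓑.localSupport_mem hRb)
        have hhA := 𝓑.measurableSet_hull hA
        have h3 := h.subadditive.enorm_indicator_le_add hf (hUP.diff hUR)
          ((hUP.inter hUR).diff hhA)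
          (disjoint_sdiff_left.mono_right (sdiff_subset.trans inter_subset_right))
          (S := 𝓑.localSupport P \ 𝓑.hull A) (by
            ext y
            have : y ∈ 𝓑.hull A → y ∈ 𝓑.localSupport R := fun hy => hAUR hy
            simp only [mem_union, mem_inter_iff, mem_sdiff]
            tauto) x
        have h4 := h.subadditive.enorm_indicator_le_add' hf
          ((hUP.inter hUR).diff hhA) (hUR.diff hUP)
          (disjoint_sdiff_right.mono_left (sdiff_subset.trans inter_subset_left))
          (S := 𝓑.localSupport R \ 𝓑.hull A) (by
            ext y
            have : y ∈ 𝓑.hull A → y ∈ 𝓑.localSupport P := fun hy => hAUP hy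
            simp only [mem_union, mem_inter_iff, mem_sdiff]
            tauto) x
        rw [Finset.sum_insert hs]
        set c : ℝ≥0∞ := 100 * K ^ 12 * Λ * ℓ
        set a := avg μ r f (𝓑.sparseBall P)
        set b := avg μ r f (𝓑.sparseBall R)
        set σ := ∑ R ∈ s, avg μ r f (𝓑.sparseBall R)
        set u := ‖T ((𝓑.localSupport P \ 𝓑.localSupport R).indicator f) x‖ₑ
        set v := ‖T ((𝓑.localSupport R \ 𝓑.localSupport P).indicator f) x‖ₑ
        set w := ‖T ((𝓑.localSupport R \ 𝓑.hull A).indicator f) x‖ₑ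
        calc _ ≤ c * (2 * σ + a) + (u + (w + v)) :=
              h1.trans (add_le_add le_rfl (h3.trans (add_le_add le_rfl h4)))
          _ = c * (2 * σ + a) + (u + v) + w := by ring
          _ ≤ c * (2 * σ + a) + c * (a + b) + w := by gcongr
          _ = c * (2 * (a + σ) + b) + w := by ring
    · have hcur := 𝓑.current_succ_of_not_exists B F hex
      obtain ⟨⟨i, hik, hPi⟩, -⟩ := 𝓑.current_mem (F := F) hx k
      rw [hcur]
      refine ⟨s, hs, fun R hR => ?_, fun A hA hxA hAR => ih A hA hxA fun _ => hAR k.succ_pos⟩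
      obtain ⟨⟨l, hl, hRl⟩, hxR⟩ := hs' R hR
      exact ⟨⟨l, hl.trans k.le_succ, hRl⟩, hxR⟩

/-- The sparse bound for the truncations of the restriction of `f` to the local support of `B`.
For a ball `A` around `x`, the telescoping is stopped at the level of `A`, and then
`bounds_of_measure_inter_lt` applies to `A`. -/
lemma exists_sparse_localSupport {c : ℕ} (hc : K ^ 2 ≤ 2 ^ c)
    (hΛ : Λ = 8 * K ^ 6 * (2 ^ (c + 5) * (c + 1) * K ^ 4))
    (hf : MemLp f (ENNReal.ofReal r) μ) (hℓ : 0 < ℓ) (hB : B ∈ 𝓑.balls) :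
    ∃ (ι : Set (Set X)) (E : ι → Set X), (∀ R : ι, 𝓑.sparseBall R ∈ 𝓑.balls) ∧
      (∀ R, MeasurableSet (E R)) ∧ (∀ R : ι, E R ⊆ 𝓑.sparseBall R) ∧
      (∀ R : ι, μ (𝓑.sparseBall R) ≤ 8 * K ^ 7 * μ (E R)) ∧
      Pairwise (Function.onFun Disjoint E) ∧
      ∀ x ∈ B, ∀ A ∈ 𝓑.balls, x ∈ A → ‖T ((𝓑.localSupport B \ 𝓑.hull A).indicator f) x‖ₑ ≤
        200 * K ^ 12 * Λ * ℓ *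
          ∑' R : ι, (𝓑.sparseBall R).indicator (fun _ => avg μ r f (𝓑.sparseBall R)) x := by
  classical
  have hK := 𝓑.one_le_const hB
  have hK' : (1 : ℝ≥0∞) ≤ K := by exact_mod_cast hK
  set δ : ℝ≥0 := 2 ^ (c + 5) * (c + 1) * K ^ 4 with hδ
  have hδ16 : 16 ≤ δ := by
    calc (16 : ℝ≥0) = 2 ^ 4 * 1 * 1 := by norm_num
      _ ≤ δ := by
        rw [hδ]
        gcongr
        · norm_num
        · omega
        · exact le_add_self
        · exact one_le_pow₀ hK
  have hδ0 : 0 < δ := lt_of_lt_of_le (by norm_num) hδ16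
  have hΛ1 : 1 ≤ Λ := by
    rw [hΛ]
    exact one_le_mul (one_le_mul (by norm_num) (one_le_pow₀ hK)) (le_trans (by norm_num) hδ16)
  -- `Λ` is chosen such that the exceptional sets are small enough for the selection to be sparse
  have hF : ∀ P ∈ 𝓑.balls, μ (𝓑.exceptionalSet r T ℓ Λ f P) ≤ (δ⁻¹ : ℝ≥0) * μ P := by
    intro P hP
    have h1 := h.mul_measure_exceptionalSet_le hf hℓ hΛ1 hP
    have hΛ0 : (Λ : ℝ≥0∞) ≠ 0 := by exact_mod_cast (zero_lt_one.trans_le hΛ1).ne'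
    refine (ENNReal.mul_le_mul_iff_right hΛ0 ENNReal.coe_ne_top).1 (h1.trans_eq ?_)
    rw [← mul_assoc, ← ENNReal.coe_mul, hΛ, mul_assoc _ δ, mul_inv_cancel₀ hδ0.ne']
    push_cast
    ring
  have hε : δ * δ⁻¹ ≤ 1 := (mul_inv_cancel₀ hδ0.ne').le
  have hε16 : 16 * δ⁻¹ ≤ 1 := (mul_le_mul_left hδ16 _).trans hε
  set F := 𝓑.exceptionalSet r T ℓ Λ f
  have hFm : ∀ P ∈ 𝓑.balls, MeasurableSet (F P) :=
    fun P _ => 𝓑.measurableSet_exceptionalSet r T ℓ Λ f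
  obtain ⟨E, hEd, hE⟩ := 𝓑.exists_disjoint_parts hB hF hFm hc hε
  refine ⟨{R | ∃ k, R ∈ 𝓑.picks B F k}, fun R => E R, fun ⟨R, k, hR⟩ => ?_, fun ⟨R, k, hR⟩ => ?_,
    fun ⟨R, k, hR⟩ => ?_, fun ⟨R, k, hR⟩ => ?_, fun R R' hne => ?_, fun x hxB A hA hxA => ?_⟩
  · exact 𝓑.sparseBall_mem (𝓑.mem_balls_of_mem_picks hB hR)
  · exact (hE k R hR).1
  · have hRb := 𝓑.mem_balls_of_mem_picks hB hR
    exact (hE k R hR).2.1.trans ((𝓑.subset_localBall hRb).trans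
      ((𝓑.localBall_subset_localSupport hRb).trans (𝓑.localSupport_subset_sparseBall hRb)))
  · calc μ (𝓑.sparseBall R) ≤ 4 * K ^ 7 * μ R :=
          𝓑.measure_sparseBall_le (𝓑.mem_balls_of_mem_picks hB hR)
      _ ≤ 4 * K ^ 7 * (2 * μ (E R)) := by gcongr; exact (hE k R hR).2.2
      _ = _ := by ring
  · exact hEd R.2 R'.2 fun h => hne (Subtype.ext h)
  · have hx : x ∈ 𝓑.hull B := 𝓑.subset_hull_self hB hxB
    -- the level of `A`
    obtain ⟨k, hk1, hk2⟩ : ∃ k, μ B < 2 ^ (k + 1) * μ A ∧ (0 < k → 2 ^ k * μ A ≤ μ B) := by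
      rcases le_or_gt (μ A) (μ B) with hAB | hAB
      · obtain ⟨k, hk⟩ := BallBasis.exists_isLevel (𝓑.measure_pos A hA).ne'
          (𝓑.measure_lt_top B hB).ne hAB
        exact ⟨k, hk.1, fun _ => hk.2⟩
      · exact ⟨0, hAB.trans_le (le_mul_of_one_le_left' (by norm_num)), by simp⟩
    obtain ⟨s, hs, hs', hT⟩ := h.exists_finset_enorm_le hf hℓ hΛ1 hB hε16 hF hx k
    have hlow := 𝓑.four_mul_measure_inter_lt hB hF hε16 hx hA hxA hk1
    obtain ⟨hPk, hxP⟩ := 𝓑.current_mem (F := F) hx k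
    set P := 𝓑.current B F k x
    have hPb := 𝓑.mem_balls_of_mem_picksUpTo hB hPk
    have hAP : 0 < k → μ A ≤ 2 * μ P := by
      intro hk0
      obtain ⟨l, hl, hPl⟩ := hPk
      exact (𝓑.isLevel_of_mem_picks hB hPl).measure_le_two_mul ⟨hk1, hk2 hk0⟩ hl
    have h1 := hT A hA hxA hAP
    have h2 := (h.bounds_of_measure_inter_lt hf hPb hA hlow).1 x hxA
    have h3 := 𝓑.avg_localSupport_le hPb h.one_le f
    set σ := ∑ R ∈ s, avg μ r f (𝓑.sparseBall R) with hσ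
    set a := avg μ r f (𝓑.sparseBall P) with ha
    have hsum : a + σ ≤ ∑' R : {R | ∃ k, R ∈ 𝓑.picks B F k},
        (𝓑.sparseBall (R : Set X)).indicator (fun _ => avg μ r f (𝓑.sparseBall R)) x := by
      have hmem : ∀ R ∈ insert P s, R ∈ 𝓑.picksUpTo B F k ∧ x ∈ 𝓑.hull R := by
        intro R hR
        rcases Finset.mem_insert.1 hR with rfl | hR
        exacts [⟨hPk, hxP⟩, hs' R hR]
      have hmem' : ∀ R ∈ insert P s, R ∈ {R | ∃ k, R ∈ 𝓑.picks B F k} := fun R hR =>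
        let ⟨l, _, hl⟩ := (hmem R hR).1
        ⟨l, hl⟩
      calc a + σ = ∑ R ∈ insert P s, avg μ r f (𝓑.sparseBall R) := by
              rw [Finset.sum_insert hs]
        _ = ∑ R ∈ insert P s,
            (𝓑.sparseBall R).indicator (fun _ => avg μ r f (𝓑.sparseBall R)) x := by
              refine Finset.sum_congr rfl fun R hR => ?_
              have hRb := 𝓑.mem_balls_of_mem_picksUpTo hB (hmem R hR).1
              rw [indicator_of_mem]
              exact 𝓑.localSupport_subset_sparseBall hRb (𝓑.localBall_subset_localSupport hRb
                (𝓑.hull_subset_localBall hRb (hmem R hR).2))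
        _ ≤ _ := by
              rw [← Finset.sum_subtype_of_mem (fun R => (𝓑.sparseBall R).indicator
                (fun _ => avg μ r f (𝓑.sparseBall R)) x) hmem']
              exact ENNReal.sum_le_tsum _
    calc _ ≤ 100 * K ^ 12 * Λ * ℓ * (2 * σ + a) + 7 * K * Λ * ℓ * (4 * K ^ 7 * a) :=
          h1.trans (add_le_add le_rfl (h2.trans (by gcongr)))
      _ = 100 * K ^ 12 * Λ * ℓ * (2 * σ + a) + 28 * K ^ 8 * Λ * ℓ * a := by ring
      _ ≤ 100 * K ^ 12 * Λ * ℓ * (2 * σ + a) + 100 * K ^ 12 * Λ * ℓ * a := by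
          gcongr <;> norm_num
      _ = 200 * K ^ 12 * Λ * ℓ * (a + σ) := by ring
      _ ≤ _ := by gcongr

end IsBOWith

/-! ### Sparse domination -/

section Domination

variable {X : Type*} [MeasurableSpace X] {𝕜 : Type*} [RCLike 𝕜] {μ : Measure X} {K : ℝ≥0}
  {𝓑 : BallBasis μ K} {r : ℝ} {T : (X → 𝕜) → X → 𝕜} {ℓ Λ : ℝ≥0} {f : X → 𝕜} {B : Set X}

lemma sparseOp_mono {𝒮 𝒮' : Set (Set X)} (h : 𝒮 ⊆ 𝒮') (f : X → 𝕜) (x : X) :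
    sparseOp μ r 𝒮 f x ≤ sparseOp μ r 𝒮' f x :=
  ENNReal.tsum_mono_subtype (fun A : Set X => A.indicator (fun _ => avg μ r f A) x) h

lemma isSparse_empty (γ : ℝ≥0) : IsSparse 𝓑 γ ∅ :=
  ⟨empty_subset _, fun _ => ∅, by simp, by simp⟩

/-- The local and the far part combined. The chain around `B` is started at `localBall B`, whose
hull is the local support of `B`. -/
lemma IsBOWith.exists_isSparse_maxTrunc_le (h : IsBOWith 𝓑 r T ℓ) {c : ℕ} (hc : K ^ 2 ≤ 2 ^ c)
    (hΛ : Λ = 8 * K ^ 6 * (2 ^ (c + 5) * (c + 1) * K ^ 4))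
    (hf : MemLp f (ENNReal.ofReal r) μ) (hℓ : 0 < ℓ) (hB : B ∈ 𝓑.balls) :
    ∃ 𝒮₁ 𝒮₂ : Set (Set X), IsSparse 𝓑 (8 * K ^ 7)⁻¹ 𝒮₁ ∧ IsSparse 𝓑 (8 * K ^ 7)⁻¹ 𝒮₂ ∧
      ∀ x ∈ B, maxTrunc 𝓑 T f x ≤
        8 * K ^ 7 * (200 * K ^ 12 * Λ + 18 * K ^ 8) * ℓ * sparseOp μ r (𝒮₁ ∪ 𝒮₂) f x := by
  have hK := 𝓑.one_le_const hB
  have hK' : (1 : ℝ≥0∞) ≤ K := by exact_mod_cast hK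
  set γ : ℝ≥0 := (8 * K ^ 7)⁻¹ with hγ
  have hK0 : 0 < K := zero_lt_one.trans_le hK
  have hγK : (8 * K ^ 7 : ℝ≥0) * γ = 1 := mul_inv_cancel₀ (by positivity)
  have hγK' : (8 * K ^ 7 : ℝ≥0∞) * γ = 1 := by exact_mod_cast hγK
  have hγle {a b : ℝ≥0∞} (hab : a ≤ 8 * K ^ 7 * b) : γ * a ≤ b := by
    calc γ * a ≤ γ * (8 * K ^ 7 * b) := by gcongr
      _ = 8 * K ^ 7 * γ * b := by ring
      _ = b := by rw [hγK', one_mul]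
  obtain ⟨ι, E, hG, hE, hEG, hμ, hd, hloc⟩ := h.exists_sparse_localSupport hc hΛ hf hℓ hB
  obtain ⟨ι', G', E', hG', hE', hEG', hμ', hd', hBG, hfar⟩ :=
    h.exists_sparse_compl_hull hℓ (𝓑.localBall_mem hB)
  obtain ⟨hs, hsum⟩ := exists_isSparse_range (𝕜 := 𝕜) 𝓑 (r := r) (γ := γ)
    (fun R : ι => 𝓑.sparseBall R) E hG hE hEG (fun R => hγle (hμ R)) hd
  obtain ⟨hs', hsum'⟩ := exists_isSparse_range (𝕜 := 𝕜) 𝓑 (r := r) (γ := γ) G' E' hG' hE' hEG'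
    (fun i => hγle ((hμ' i).trans (by gcongr <;> norm_num))) hd'
  refine ⟨_, _, hs, hs', fun x hx => iSup₂_le fun A hA => iSup_le fun hxA => ?_⟩
  set 𝒮₁ := range fun R : ι => 𝓑.sparseBall R
  set 𝒮₂ := range G'
  have hUm := 𝓑.measurableSet_ball _ (𝓑.localSupport_mem hB)
  have hAm := 𝓑.measurableSet_hull hA
  have h1 := hloc x hx A hA hxA
  have h2 : ‖T (((𝓑.hull A)ᶜ \ 𝓑.localSupport B).indicator f) x‖ₑ ≤
      18 * K ^ 8 * ℓ * ∑' i, (G' i).indicator (fun _ => avg μ r f (G' i)) x := by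
    have := hfar x (𝓑.subset_localBall hB hx) _ (hf.indicator hAm.compl)
    rw [indicator_indicator, inter_comm, ← sdiff_eq] at this
    refine this.trans ?_
    gcongr with i
    rw [indicator_of_mem (hBG i (𝓑.subset_localBall hB hx))]
    exact avg_indicator_le h.one_le
  have h3 := h.subadditive.enorm_indicator_le_add hf (hUm.diff hAm) (hAm.compl.diff hUm)
    (disjoint_sdiff_right.mono_left sdiff_subset) (S := (𝓑.hull A)ᶜ) (by
      ext y
      simp only [mem_union, mem_compl_iff, mem_sdiff]
      tauto) x
  set σ := ∑' R : ι, (𝓑.sparseBall R).indicator (fun _ => avg μ r f (𝓑.sparseBall R)) x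
  set σ' := ∑' i, (G' i).indicator (fun _ => avg μ r f (G' i)) x
  have e1 : γ * σ ≤ sparseOp μ r (𝒮₁ ∪ 𝒮₂) f x :=
    (hsum f x).trans (sparseOp_mono subset_union_left f x)
  have e2 : γ * σ' ≤ sparseOp μ r (𝒮₁ ∪ 𝒮₂) f x :=
    (hsum' f x).trans (sparseOp_mono subset_union_right f x)
  calc ‖T ((𝓑.hull A)ᶜ.indicator f) x‖ₑ
      ≤ 200 * K ^ 12 * Λ * ℓ * σ + 18 * K ^ 8 * ℓ * σ' := h3.trans (add_le_add h1 h2)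
    _ = 8 * K ^ 7 * γ * (200 * K ^ 12 * Λ * ℓ * σ + 18 * K ^ 8 * ℓ * σ') := by
        rw [hγK', one_mul]
    _ = 8 * K ^ 7 * (200 * K ^ 12 * Λ * ℓ * (γ * σ) + 18 * K ^ 8 * ℓ * (γ * σ')) := by ring
    _ ≤ 8 * K ^ 7 * (200 * K ^ 12 * Λ * ℓ * sparseOp μ r (𝒮₁ ∪ 𝒮₂) f x +
          18 * K ^ 8 * ℓ * sparseOp μ r (𝒮₁ ∪ 𝒮₂) f x) := by gcongr
    _ = _ := by ring

lemma IsBO.isBOWith (h : IsBO 𝓑 r T) (hr : 1 ≤ r) (hℓ : 0 < ℓ)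
    (hlt : constL1 𝓑 r T + constL2 𝓑 r T + weakNorm μ r T < ℓ) : IsBOWith 𝓑 r T ℓ := by
  have hℓ0 : (ℓ : ℝ≥0∞) ≠ 0 := by exact_mod_cast hℓ.ne'
  have h1 : constL1 𝓑 r T ≤ ℓ := (le_self_add.trans le_self_add).trans hlt.le
  have h2 : constL2 𝓑 r T < ℓ := (le_add_self.trans le_self_add).trans_lt hlt
  have h3 : weakNorm μ r T ≤ ℓ := le_add_self.trans hlt.le
  have hdiv {a b : ℝ≥0∞} (hab : a / b ≤ ℓ) : a ≤ ℓ * b :=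
    (ENNReal.div_le_iff_le_mul (Or.inr ENNReal.coe_ne_top) (Or.inr hℓ0)).1 hab
  refine ⟨hr, h.subadditive, fun B hB x hx x' hx' f hf => hdiv (le_trans ?_ h1),
    fun A hA hne => ?_, fun f hf t ht => hdiv (le_trans ?_ h3)⟩
  · exact le_iSup₂_of_le B hB <| le_iSup₂_of_le x hx <| le_iSup₂_of_le x' hx' <|
      le_iSup₂_of_le f hf le_rfl
  · obtain ⟨c, hc, hcℓ⟩ := sInf_lt_iff.1 h2
    obtain ⟨B, hB, hAB, hΔ⟩ := hc A hA hne
    refine ⟨B, hB, hAB, fun x hx f hf => hdiv (le_trans ?_ (hΔ.trans hcℓ.le))⟩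
    exact le_iSup₂_of_le x hx <| le_iSup₂_of_le f hf le_rfl
  · have hset : {x | (t : ℝ≥0∞) < ‖T f x‖ₑ} = {x | (t : ℝ) < ‖T f x‖} := by
      ext x
      simp only [mem_ofPred_eq, enorm_eq_nnnorm, ENNReal.coe_lt_coe, ← NNReal.coe_lt_coe,
        coe_nnnorm]
    rw [hset]
    exact le_iSup₂_of_le t ht <| le_iSup₂_of_le f hf le_rfl

/-- If all three constants of `T` vanish, then so does the maximal truncation. -/
lemma IsBO.maxTrunc_eq_zero (h : IsBO 𝓑 r T) (hr : 1 ≤ r)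
    (h0 : constL1 𝓑 r T + constL2 𝓑 r T + weakNorm μ r T = 0)
    (hf : MemLp f (ENNReal.ofReal r) μ) (x : X) : maxTrunc 𝓑 T f x = 0 := by
  refine le_antisymm (iSup₂_le fun A hA => iSup_le fun hxA => ?_) zero_le
  have hm := mean_ne_top hr hf (𝓑.measure_pos A hA).ne'
  lift mean μ r f (μ A) to ℝ≥0 using hm with a ha
  refine ENNReal.le_of_forall_pos_le_add fun ε hε _ => ?_
  have hℓ : 0 < ε / (3 * (a + 1)) := by positivity
  have hbo := h.isBOWith hr hℓ (by rw [h0]; exact_mod_cast hℓ)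
  rw [zero_add]
  refine (hbo.enorm_compl_hull_le hf hℓ hA hxA).trans ?_
  rw [← ha]
  have : 3 * (ε / (3 * (a + 1))) * a ≤ ε := by
    calc 3 * (ε / (3 * (a + 1))) * a ≤ 3 * (ε / (3 * (a + 1))) * (a + 1) := by
          gcongr; exact le_self_add
      _ = ε := by field_simp
  exact_mod_cast this

end Domination

theorem theorem2 (K : ℝ≥0) :
    ∃ γ C : ℝ≥0, 0 < γ ∧ γ < 1 ∧ 0 < C ∧
      ∀ {X : Type*} [MeasurableSpace X] {𝕜 : Type*} [RCLike 𝕜] (μ : Measure X)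
        (𝓑 : BallBasis μ K) (r : ℝ), 1 ≤ r →
        ∀ T : (X → 𝕜) → X → 𝕜, IsBO 𝓑 r T → weakNorm μ r T < ∞ →
          ∀ f : X → 𝕜, MemLp f (ENNReal.ofReal r) μ → ∀ B ∈ 𝓑.balls,
            ∃ 𝒮₁ 𝒮₂ : Set (Set X), IsSparse 𝓑 γ 𝒮₁ ∧ IsSparse 𝓑 γ 𝒮₂ ∧
              ∀ᵐ x ∂μ, x ∈ B →
                maxTrunc 𝓑 T f x ≤
                  C * (constL1 𝓑 r T + constL2 𝓑 r T + weakNorm μ r T) *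
                    sparseOp μ r (𝒮₁ ∪ 𝒮₂) f x := by
  by_cases hK : 1 ≤ K
  swap
  -- a ball-basis with constant less than `1` has no balls
  · exact ⟨1 / 2, 1, by norm_num, by rw [← NNReal.coe_lt_coe]; norm_num, one_pos,
      fun μ 𝓑 _ _ _ _ _ _ _ B hB => absurd (𝓑.one_le_const hB) hK⟩
  obtain ⟨c, hc⟩ := pow_unbounded_of_one_lt (K ^ 2) (one_lt_two (α := ℝ≥0))
  set Λ : ℝ≥0 := 8 * K ^ 6 * (2 ^ (c + 5) * (c + 1) * K ^ 4) with hΛ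
  have hK0 : 0 < K := zero_lt_one.trans_le hK
  refine ⟨(8 * K ^ 7)⁻¹, 8 * K ^ 7 * (200 * K ^ 12 * Λ + 18 * K ^ 8) * 2, by positivity, ?_,
    by positivity, fun {X _ 𝕜 _} μ 𝓑 r hr T hT hW f hf B hB => ?_⟩
  · refine inv_lt_one_of_one_lt₀ (lt_of_lt_of_le (b := (8 : ℝ≥0)) (by norm_num) ?_)
    exact le_mul_of_one_le_right' (one_le_pow₀ hK)
  set 𝓛 := constL1 𝓑 r T + constL2 𝓑 r T + weakNorm μ r T
  by_cases h0 : 𝓛 = 0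
  · refine ⟨∅, ∅, isSparse_empty _, isSparse_empty _, .of_forall fun x _ => ?_⟩
    rw [hT.maxTrunc_eq_zero hr h0 hf]
    exact zero_le
  -- the infimum defining `constL2` need not be attained, whence the factor `2`
  have hfin : 𝓛 ≠ ∞ := (ENNReal.add_lt_top.2
    ⟨ENNReal.add_lt_top.2 ⟨hT.localization, hT.connectivity⟩, hW⟩).ne
  have hcoe : ((2 * 𝓛.toNNReal : ℝ≥0) : ℝ≥0∞) = 2 * 𝓛 := by
    rw [ENNReal.coe_mul, ENNReal.coe_toNNReal hfin, ENNReal.coe_ofNat]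
  have hℓ : 0 < 2 * 𝓛.toNNReal := mul_pos two_pos (ENNReal.toNNReal_pos h0 hfin)
  have hbo := hT.isBOWith hr hℓ (by
    rw [hcoe, two_mul]
    exact ENNReal.lt_add_right hfin h0)
  obtain ⟨𝒮₁, 𝒮₂, h₁, h₂, hle⟩ := hbo.exists_isSparse_maxTrunc_le hc.le hΛ hf hℓ hB
  refine ⟨𝒮₁, 𝒮₂, h₁, h₂, .of_forall fun x hx => (hle x hx).trans_eq ?_⟩
  rw [hcoe]
  push_cast
  ring
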